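/- Let $G$ be an infinite countable discrete amenable group acting by invertible measure-preserving transformations on a complete probability space $(\Omega,\mathcal F,\mathbb P)$. Let $X$ be a compact metric space with Borel $\sigma$-algebra $\mathcal B_X$. A *continuous bundle RDS* over $(\Omega,\mathcal F,\mathbb P,G)$ with state space $X$ consists of a set $\mathcal E\in\mathcal F\times\mathcal B_X$ with fibers $\mathcal E_\omega=\{x:(\omega,x)\in\mathcal E\}$ and maps $F_{g,\omega}:\mathcal E_\omega\to\mathcal E_{g\omega}$ ($g\in G$, $\omega\in\Omega$) such that $F_{e,\omega}=\mathrm{id}$, $F_{g_2,g_1\omega}\circ F_{g_1,\omega}=F_{g_2g_1,\omega}$, the map $(\omega,x)\mapsto F_{g,\omega}(x)$ is measurable for each $g$, and for $\mathbb P$-a.e. $\omega$ the fiber $\mathcal E_\omega$ is non-empty and compact and all $F_{g,\omega}$ are continuous. $G$ acts on $\mathcal E$ by $g(\omega,x)=(g\omega,F_{g,\omega}x)$. Finite covers and finite partitions (whose members may be empty) of a measurable space consist of measurable sets. A cover $\mathcal W_1$ is finer than $\mathcal W_2$, written $\mathcal W_1\succeq\mathcal W_2$, if each member of $\mathcal W_1$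 is contained in a member of $\mathcal W_2$. For $S\subseteq\mathcal E$ write $S_\omega=\{x:(\omega,x)\in S\}$. Let $\mathbf C^o_{\mathcal E}$ be the set of finite covers $\mathcal U$ of $\mathcal E$ such that for each $U\in\mathcal U$ the set $U_\omega$ is open in $\mathcal E_\omega$ for $\mathbb P$-a.e. $\omega$. For a finite cover $\mathcal U=\{U_1,\dots,U_N\}$ of $\mathcal E$ let $\mathbf P_{\mathcal U}$ be the set of finite partitions $\{A_1,\dots,A_N\}$ of $\mathcal E$ with $A_i\subseteq U_i$ for all $i$. Let $\mathcal P_{\mathbb P}(\mathcal E)$ be the set of probability measures on $\mathcal E$ with marginal $\mathbb P$ on $\Omega$, and $\mathcal P_{\mathbb P}(\mathcal E,G)$ the set of its $G$-invariant elements. Let $\mathcal F_{\mathcal E}=\{(A\times X)\cap\mathcal E:A\in\mathcal F\}$. For a finite partition $\alpha$ of $\mathcal E$ and a sub-$\sigma$-algebra $\mathcal C$ put $$H_\mu(\alpha|\mathcal C)=-\sum_{A\in\alpha}\int\mu(A|\mathcal C)\log\mu(A|\mathcal C)\,d\mu\quad(0\log 0=0).$$ For $\mu\in\mathcal P_{\mathbb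 P}(\mathcal E,G)$ put $$h^{(r)}_\mu(\mathbf F,\alpha)=\lim_{n\to\infty}\frac1{|\Phi_n|}H_\mu\Big(\bigvee_{g\in \Phi_n}g^{-1}\alpha\,\Big|\,\mathcal F_{\mathcal E}\Big),\qquad h^{(r)}_{\mu,+}(\mathbf F,\mathcal U)=\inf_{\alpha\succeq\mathcal U}h_\mu^{(r)}(\mathbf F,\alpha),$$ where $(\Phi_n)$ is a Følner sequence of $G$, that is, a sequence of non-empty finite subsets with $|g\Phi_n\Delta\Phi_n|/|\Phi_n|\to0$ for all $g\in G$ (the limit does not depend on its choice), and the infimum is over the finite partitions $\alpha$ of $\mathcal E$ finer than $\mathcal U$. A finite cover $\mathcal U$ of $\mathcal E$ is *excellent* (respectively *good*) if there is a sequence $(\alpha_n)_{n\in\mathbb N}$ in $\mathbf P_{\mathcal U}$ such that for each $n$, for $\mathbb P$-a.e. $\omega$, the sets $A_\omega$ ($A\in\alpha_n$) are clopen in $\mathcal E_\omega$, and * (excellent) for all $\beta\in\mathbf P_{\mathcal U}$ and $\mu\in\mathcal P_{\mathbb P}(\mathcal E)$: $\ \inf_n\big[H_\mu(\beta|\alpha_n\vee\mathcal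 F_{\mathcal E})+H_\mu(\alpha_n|\beta\vee\mathcal F_{\mathcal E})\big]=0$; * (good) for all $\mu\in\mathcal P_{\mathbb P}(\mathcal E,G)$: $\ h^{(r)}_{\mu,+}(\mathbf F,\mathcal U)=\inf_n h^{(r)}_\mu(\mathbf F,\alpha_n)$. A *factor map* from a continuous bundle RDS $\mathbf F'$ (on $\mathcal E'$, with a compact metric state space $X'$) to $\mathbf F$, over the same base, is a measurable map $\pi:\mathcal E'\to\mathcal E$ which, for $\mathbb P$-a.e. $\omega$, restricts to a continuous surjection $\pi_\omega:\mathcal E'_\omega\to\mathcal E_\omega$, and which satisfies $\pi_{g\omega}\circ F'_{g,\omega}=F_{g,\omega}\circ\pi_\omega$ for each $g$ and $\mathbb P$-a.e. $\omega$. A cover $\mathcal U\in\mathbf C^o_{\mathcal E}$ is *factor excellent* (*factor good*) if there is such a factor map $\pi$ for which $\pi^{-1}\mathcal U$ is excellent (good). **Theorem.** Assume that $(\Omega,\mathcal F,\mathbb P)$ is a Lebesgue space, i.e. complete and isomorphic modulo null sets to the completion of a Borel probability measure on a standard Borel space. Let $\mathbf F$ be a continuous bundle RDS over $(\Omega,\mathcal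 F,\mathbb P,G)$ with state space the compact metric space $X$. 1. If $\xi$ is a finite measurable partition of $\Omega$ and $\mathcal V$ is a finite open cover of $X$, then $(\xi\times\mathcal V)_{\mathcal E}=\{(C\times V)\cap\mathcal E:C\in\xi,\ V\in\mathcal V\}$ is factor excellent. 2. If $n\ge2$, $\Omega_1,\dots,\Omega_n\in\mathcal F$, and $U_1,\dots,U_n\subseteq X$ are such that $\{U_1^c,\dots,U_n^c\}$ is an open cover of $X$, then $\mathcal U=\{(\Omega_i\times U_i)^c:i=1,\dots,n\}$ (complements taken in $\mathcal E$) is factor good. -/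

import Mathlib

open MeasureTheory Filter Topology

/-! ### Amenable groups -/

/-- A discrete group is amenable if for every non-empty finite `K` and every `δ > 0` there is a
non-empty finite `F` with `|F Δ K F| < δ |F|`. -/
def IsAmenableGroup (G : Type*) [Group G] : Prop :=
  ∀ K : Set G, K.Finite → K.Nonempty → ∀ δ : ℝ, 0 < δ →
    ∃ F : Set G, F.Finite ∧ F.Nonempty ∧
      ((symmDiff F (Set.image2 (· * ·) K F)).ncard : ℝ) < δ * F.ncard

/-- A Følner sequence: non-empty finite sets `Φ n` with `|g Φₙ Δ Φₙ| / |Φₙ| → 0` for each `g`. -/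
def IsFolnerSequence {G : Type*} [Group G] (Φ : ℕ → Finset G) : Prop :=
  (∀ n, (Φ n).Nonempty) ∧
    ∀ g : G, Tendsto
      (fun n => ((symmDiff ((fun h => g * h) '' (Φ n : Set G)) (Φ n : Set G)).ncard : ℝ)
        / (Φ n).card) atTop (𝓝 0)

/-! ### Finite covers, finite partitions and conditional entropy -/

section MeasurableCovers

variable {Y : Type*} [MeasurableSpace Y]

/-- Finite covers of `Y` by measurable sets. -/
structure IsFiniteCover (𝒲 : Set (Set Y)) : Prop where
  finite : 𝒲.Finite
  measurableSet : ∀ W ∈ 𝒲, MeasurableSet W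
  sUnion_eq : ⋃₀ 𝒲 = Set.univ

/-- Finite partitions of `Y`: finite measurable covers with pairwise disjoint members
(the empty set is allowed as a member). -/
structure IsFinitePartition (α : Set (Set Y)) : Prop extends IsFiniteCover α where
  pairwiseDisjoint : α.PairwiseDisjoint id

/-- `𝒲₁` is finer than `𝒲₂`: each member of `𝒲₁` is contained in a member of `𝒲₂`. -/
def IsFiner (𝒲₁ 𝒲₂ : Set (Set Y)) : Prop :=
  ∀ A ∈ 𝒲₁, ∃ B ∈ 𝒲₂, A ⊆ B

/-- For a cover `𝒰 = {U₁, …, U_N}`, the set of finite partitions `{A₁, …, A_N}` of `Y` such that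
`Aᵢ ⊆ Uᵢ` for each `i`. -/
def subordinatePartitions (𝒰 : Set (Set Y)) : Set (Set (Set Y)) :=
  {α | IsFinitePartition α ∧ ∃ A : 𝒰 → Set Y, (∀ U : 𝒰, A U ⊆ (U : Set Y)) ∧ Set.range A = α}

/-- The conditional entropy `H_ν(α | 𝒞) = - ∑_{A ∈ α} ∫ ν(A | 𝒞) log ν(A | 𝒞) dν` of a finite
partition `α` (recall that `Real.negMulLog t = - t * log t`). -/
noncomputable def condEntropy (ν : Measure Y) (α : Set (Set Y)) (𝒞 : MeasurableSpace Y) : ℝ :=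
  ∑ᶠ A ∈ α, ∫ y, Real.negMulLog ((ν[A.indicator (fun _ => (1 : ℝ)) | 𝒞]) y) ∂ν

end MeasurableCovers

/-- Finite open covers of a topological space. -/
structure IsFiniteOpenCover {X : Type*} [TopologicalSpace X] (𝒱 : Set (Set X)) : Prop where
  finite : 𝒱.Finite
  isOpen : ∀ V ∈ 𝒱, IsOpen V
  sUnion_eq : ⋃₀ 𝒱 = Set.univ

/-! ### Lebesgue spaces -/

/-- `(Ω, P)` is a Lebesgue space: it is complete and isomorphic modulo null sets to the completion
of a Borel probability measure on a standard Borel space. (`NullMeasurableSpace Z p` is `Z` with the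
`p`-completion of its `σ`-algebra.) -/
def IsLebesgueSpace {Ω : Type*} [MeasurableSpace Ω] (P : Measure Ω) : Prop :=
  P.IsComplete ∧
    ∃ (Z : Type) (_ : MeasurableSpace Z) (_ : StandardBorelSpace Z)
      (p : Measure Z) (_ : IsProbabilityMeasure p)
      (Ω₀ : Set Ω) (Z₀ : Set (NullMeasurableSpace Z p)) (e : Ω₀ ≃ᵐ Z₀),
      MeasurableSet Ω₀ ∧ MeasurableSet Z₀ ∧ P Ω₀ᶜ = 0 ∧ p.completion Z₀ᶜ = 0 ∧
        MeasurePreserving e (P.comap Subtype.val) (p.completion.comap Subtype.val)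

/-! ### Continuous bundle random dynamical systems -/

/-- A continuous bundle random dynamical system over `(Ω, P, G)` with state space `X`:
a measurable set `E ⊆ Ω × X` and maps `F_{g,ω} : E_ω → E_{gω}`, where `map g (ω, x) = F_{g,ω}(x)`
for `(ω, x) ∈ E`. -/
structure ContinuousBundleRDS (G : Type*) {Ω : Type*} [Group G] [MulAction G Ω] [MeasurableSpace Ω]
    (P : Measure Ω) (X : Type*) [MetricSpace X] [MeasurableSpace X] where
  E : Set (Ω × X)
  measurableSet_E : MeasurableSet E
  map : G → E → X
  map_mem : ∀ (g : G) (p : E), (g • p.1.1, map g p) ∈ E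
  map_one : ∀ p : E, map 1 p = p.1.2
  measurable_map : ∀ g : G, Measurable (map g)
  map_map : ∀ (g₁ g₂ : G) (p : E),
    map g₂ ⟨(g₁ • p.1.1, map g₁ p), map_mem g₁ p⟩ = map (g₂ * g₁) p
  ae_fiber : ∀ᵐ ω ∂P, {x : X | (ω, x) ∈ E}.Nonempty ∧ IsCompact {x : X | (ω, x) ∈ E} ∧
    ∀ g : G, Continuous fun x : {x : X | (ω, x) ∈ E} => map g ⟨(ω, x.1), x.2⟩

namespace ContinuousBundleRDS

variable {G Ω X : Type*} [Group G] [MulAction G Ω] [MeasurableSpace Ω] {P : Measure Ω}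
  [MetricSpace X] [MeasurableSpace X]

/-- The fiber `E_ω`. -/
def fiber (F : ContinuousBundleRDS G P X) (ω : Ω) : Set X :=
  {x : X | (ω, x) ∈ F.E}

/-- The fiber `S_ω` of a set `S ⊆ E`, as a subset of the space `E_ω`. -/
def fiberSet (F : ContinuousBundleRDS G P X) (S : Set F.E) (ω : Ω) : Set (F.fiber ω) :=
  {x | (⟨(ω, x.1), x.2⟩ : F.E) ∈ S}

/-- The skew product transformation `(ω, x) ↦ (g ω, F_{g,ω} x)` of `E`. -/
def skew (F : ContinuousBundleRDS G P X) (g : G) (p : F.E) : F.E :=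
  ⟨(g • p.1.1, F.map g p), F.map_mem g p⟩

/-- Finite covers of `E` by open random sets: `S_ω` is open in `E_ω` for a.e. `ω`. -/
def IsOpenRandomCover (F : ContinuousBundleRDS G P X) (𝒰 : Set (Set F.E)) : Prop :=
  IsFiniteCover 𝒰 ∧ ∀ U ∈ 𝒰, ∀ᵐ ω ∂P, IsOpen (F.fiberSet U ω)

/-- `α_ω` consists of clopen subsets of `E_ω` for a.e. `ω`. -/
def IsFiberwiseClopen (F : ContinuousBundleRDS G P X) (α : Set (Set F.E)) : Prop :=
  ∀ᵐ ω ∂P, ∀ A ∈ α, IsClopen (F.fiberSet A ω)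

/-- The `σ`-algebra `ℱ_E` of all sets `(A × X) ∩ E` with `A` measurable in `Ω`. -/
abbrev baseAlgebra (F : ContinuousBundleRDS G P X) : MeasurableSpace F.E :=
  MeasurableSpace.comap (fun p : F.E => p.1.1) inferInstance

/-- The measures on `E` with marginal `P` on `Ω`. Since `E` is measurable, these are the
measures on `Ω × X` with marginal `P` which give full measure to `E`. -/
def HasMarginal (F : ContinuousBundleRDS G P X) (μ : Measure F.E) : Prop :=
  μ.map (fun p : F.E => p.1.1) = P

/-- The measures on `E` with marginal `P` which are invariant under the skew product action. -/
def IsInvariant (F : ContinuousBundleRDS G P X) (μ : Measure F.E) : Prop :=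
  F.HasMarginal μ ∧ ∀ g : G, μ.map (F.skew g) = μ

/-- The join `α_K = ⋁_{g ∈ K} g⁻¹ α`, for a finite `K ⊆ G` and the skew product action. -/
def joinOver (F : ContinuousBundleRDS G P X) (α : Set (Set F.E)) (K : Finset G) : Set (Set F.E) :=
  {S | ∃ s : G → Set F.E, (∀ g ∈ K, s g ∈ α) ∧ S = ⋂ g ∈ K, F.skew g ⁻¹' s g}

/-- The fiber entropy `h_μ^{(r)}(F, α) = lim_n H_μ(α_{Φₙ} | ℱ_E) / |Φₙ|` of a finite partition `α`,
for the Følner sequence `Φ` (its value does not depend on `Φ`). -/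
noncomputable def fiberEntropy (F : ContinuousBundleRDS G P X) (Φ : ℕ → Finset G)
    (μ : Measure F.E) (α : Set (Set F.E)) : ℝ :=
  limUnder atTop fun n => condEntropy μ (F.joinOver α (Φ n)) F.baseAlgebra / ((Φ n).card : ℝ)

/-- The entropy `h_{μ,+}^{(r)}(F, 𝒰)` of a finite cover: the infimum of `h_μ^{(r)}(F, α)` over all
finite partitions `α` of `E` which are finer than `𝒰`. -/
noncomputable def fiberEntropyPlus (F : ContinuousBundleRDS G P X) (Φ : ℕ → Finset G)
    (μ : Measure F.E) (𝒰 : Set (Set F.E)) : ℝ :=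
  sInf {h | ∃ α : Set (Set F.E), IsFinitePartition α ∧ IsFiner α 𝒰 ∧ h = F.fiberEntropy Φ μ α}

/-- `𝒰` is excellent. -/
def IsExcellent (F : ContinuousBundleRDS G P X) (𝒰 : Set (Set F.E)) : Prop :=
  ∃ α : ℕ → Set (Set F.E),
    (∀ n, α n ∈ subordinatePartitions 𝒰) ∧ (∀ n, F.IsFiberwiseClopen (α n)) ∧
    ∀ β ∈ subordinatePartitions 𝒰, ∀ μ : Measure F.E, F.HasMarginal μ →
      ⨅ n, (condEntropy μ β (MeasurableSpace.generateFrom (α n) ⊔ F.baseAlgebra) +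
        condEntropy μ (α n) (MeasurableSpace.generateFrom β ⊔ F.baseAlgebra)) = 0

/-- `𝒰` is good. -/
def IsGood (F : ContinuousBundleRDS G P X) (𝒰 : Set (Set F.E)) : Prop :=
  ∃ α : ℕ → Set (Set F.E),
    (∀ n, α n ∈ subordinatePartitions 𝒰) ∧ (∀ n, F.IsFiberwiseClopen (α n)) ∧
    ∀ Φ : ℕ → Finset G, IsFolnerSequence Φ → ∀ μ : Measure F.E, F.IsInvariant μ →
      F.fiberEntropyPlus Φ μ 𝒰 = ⨅ n, F.fiberEntropy Φ μ (α n)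

/-- Factor maps `π : E₁ → E₂` between continuous bundle random dynamical systems over the same
base. -/
structure IsFactorMap {X₁ X₂ : Type*} [MetricSpace X₁] [MeasurableSpace X₁]
    [MetricSpace X₂] [MeasurableSpace X₂] (F₁ : ContinuousBundleRDS G P X₁)
    (F₂ : ContinuousBundleRDS G P X₂) (π : F₁.E → F₂.E) : Prop where
  measurable : Measurable π
  ae_fiber : ∀ᵐ ω ∂P,
    (∀ p : F₁.E, p.1.1 = ω → (π p).1.1 = ω) ∧
    (Continuous fun x : F₁.fiber ω => (π ⟨(ω, x.1), x.2⟩).1.2) ∧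
    ∀ q : F₂.E, q.1.1 = ω → ∃ p : F₁.E, p.1.1 = ω ∧ π p = q
  equivariant : ∀ g : G, ∀ᵐ ω ∂P, ∀ p : F₁.E, p.1.1 = ω → π (F₁.skew g p) = F₂.skew g (π p)

/-- An open random cover `𝒰` is factor excellent if `π⁻¹ 𝒰` is excellent for some factor map `π`
onto `F` from a continuous bundle random dynamical system `F'` with compact metric state space. -/
def IsFactorExcellent (F : ContinuousBundleRDS G P X) (𝒰 : Set (Set F.E)) : Prop :=
  F.IsOpenRandomCover 𝒰 ∧
    ∃ (X' : Type) (_ : MetricSpace X') (_ : CompactSpace X') (_ : MeasurableSpace X')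
      (_ : BorelSpace X') (F' : ContinuousBundleRDS G P X') (π : F'.E → F.E),
      IsFactorMap F' F π ∧ F'.IsExcellent ((fun U => π ⁻¹' U) '' 𝒰)

/-- An open random cover `𝒰` is factor good if `π⁻¹ 𝒰` is good for some factor map `π`
onto `F` from a continuous bundle random dynamical system `F'` with compact metric state space. -/
def IsFactorGood (F : ContinuousBundleRDS G P X) (𝒰 : Set (Set F.E)) : Prop :=
  F.IsOpenRandomCover 𝒰 ∧
    ∃ (X' : Type) (_ : MetricSpace X') (_ : CompactSpace X') (_ : MeasurableSpace X')
      (_ : BorelSpace X') (F' : ContinuousBundleRDS G P X') (π : F'.E → F.E),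
      IsFactorMap F' F π ∧ F'.IsGood ((fun U => π ⁻¹' U) '' 𝒰)

/-- The cover `(ξ × 𝒱)_E = {(C × V) ∩ E : C ∈ ξ, V ∈ 𝒱}` of `E`. -/
def prodCover (F : ContinuousBundleRDS G P X) (ξ : Set (Set Ω)) (𝒱 : Set (Set X)) :
    Set (Set F.E) :=
  {S | ∃ C ∈ ξ, ∃ V ∈ 𝒱, S = {p : F.E | p.1 ∈ C ×ˢ V}}

/-- The family `{(Ωᵢ × Uᵢ)ᶜ : i}`, with complements taken in `E`. -/
def complCover (F : ContinuousBundleRDS G P X) {n : ℕ} (Ωs : Fin n → Set Ω) (U : Fin n → Set X) :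
    Set (Set F.E) :=
  Set.range fun i => {p : F.E | p.1 ∈ Ωs i ×ˢ U i}ᶜ

end ContinuousBundleRDS

/-! Both covers consist of sets `(C × X) ∩ ((D × X) ∪ (Ω × V))` with `V` open: for the product cover
`D` is empty, for the complement cover `C` is all of `Ω`. So one construction serves both
statements, and the second is first obtained in the stronger form "factor excellent".

The factor makes the state space zero-dimensional. Choose a continuous surjection of the Cantor
space onto `X`, and over `ω` take all points of the full `G`-shift on the Cantor space whose images
in `X` form an `F`-orbit above `ω`. The shift acts on this bundle, and the coordinate at `1`
projects it onto `E` (`orbitExtension`, `isFactorMap_orbitProj`).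

In a zero-dimensional state space an open set is an increasing union of clopen sets. A Lebesgue base
has a countable dense family of measurable sets; with the clopen sets it generates a countable
algebra whose members have clopen fibers. Since the marginal is always `P`, this one algebra is
dense for every admissible measure (`HasMarginal.measureDense`). Compactness allows every
subordinate partition to be approximated by subordinate partitions from the algebra
(`exists_subordinate_family`), and `entropyTerm_le_sqrt` turns small symmetric differences into
small conditional entropies. This is excellence (`isExcellent_of_totallyDisconnected`).

Excellence implies goodness because fiber entropy changes by at most a conditional entropy
(`fiberEntropy_le_add`). That rests on the chain rule and on convergence along Følner sequences,
which follows from submodularity (`tendsto_of_submodular`). -/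

/-! ### Conditional entropy of single sets and the chain rule. -/

section ConditionalEntropy

open scoped symmDiff

variable {Y : Type*} {𝒞 𝒟 : MeasurableSpace Y} {mY : MeasurableSpace Y}

/-- The conditional probability `ν(A | 𝒞)`. -/
noncomputable abbrev condProbOf (ν : Measure Y) (A : Set Y) (𝒞 : MeasurableSpace Y) : Y → ℝ :=
  ν[A.indicator (fun _ => (1 : ℝ)) | 𝒞]

/-- The contribution `- ∫ ν(A | 𝒞) log ν(A | 𝒞) dν` of a set `A` to a conditional entropy. -/
noncomputable def entropyTerm (ν : Measure Y) (A : Set Y) (𝒞 : MeasurableSpace Y) : ℝ :=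
  ∫ y, Real.negMulLog (condProbOf ν A 𝒞 y) ∂ν

theorem condEntropy_eq_sum {ν : Measure Y} {α : Set (Set Y)} (hα : α.Finite) :
    condEntropy ν α 𝒞 = ∑ A ∈ hα.toFinset, entropyTerm ν A 𝒞 :=
  finsum_mem_eq_finite_toFinset_sum _ hα

variable {ν : Measure Y} [IsProbabilityMeasure ν]

theorem integrable_indicator_one {A : Set Y} (hA : MeasurableSet A) :
    Integrable (A.indicator fun _ => (1 : ℝ)) ν :=
  (integrable_const 1).indicator hA

theorem condProbOf_mem_Icc {A : Set Y} (hA : MeasurableSet A) :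
    ∀ᵐ y ∂ν, condProbOf ν A 𝒞 y ∈ Set.Icc (0 : ℝ) 1 := by
  have h0 : 0 ≤ᵐ[ν] condProbOf ν A 𝒞 := condExp_nonneg (Eventually.of_forall fun y => by
    by_cases h : y ∈ A <;> simp [h])
  by_cases hm : 𝒞 ≤ mY
  · have h1 : condProbOf ν A 𝒞 ≤ᵐ[ν] ν[(fun _ => (1 : ℝ)) | 𝒞] :=
      condExp_mono (integrable_indicator_one hA) (integrable_const 1)
        (Eventually.of_forall fun y => by by_cases h : y ∈ A <;> simp [h])
    rw [condExp_const hm] at h1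
    filter_upwards [h0, h1] with y hy0 hy1 using ⟨hy0, hy1⟩
  -- If `𝒞` is not a sub-σ-algebra, the conditional expectation is `0` by default, which still lies
  -- in the interval.
  · refine Eventually.of_forall fun y => ?_
    simp [condProbOf, condExp_of_not_le hm]

theorem negMulLog_mem_Icc {t : ℝ} (ht : t ∈ Set.Icc (0 : ℝ) 1) :
    Real.negMulLog t ∈ Set.Icc (0 : ℝ) 1 :=
  ⟨Real.negMulLog_nonneg ht.1 ht.2,
    (Real.negMulLog_le_one_sub_self ht.1).trans (by linarith [ht.1])⟩

theorem integrable_of_ae_mem_Icc {f : Y → ℝ} (hf : AEStronglyMeasurable f ν)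
    (h : ∀ᵐ y ∂ν, f y ∈ Set.Icc (0 : ℝ) 1) : Integrable f ν :=
  Integrable.of_bound hf 1 <| by
    filter_upwards [h] with y hy
    rw [Real.norm_eq_abs, abs_of_nonneg hy.1]
    exact hy.2

theorem integrable_negMulLog_condProbOf {A : Set Y} (hA : MeasurableSet A) :
    Integrable (fun y => Real.negMulLog (condProbOf ν A 𝒞 y)) ν :=
  integrable_of_ae_mem_Icc
    (Real.continuous_negMulLog.comp_aestronglyMeasurable integrable_condExp.aestronglyMeasurable)
    (by filter_upwards [condProbOf_mem_Icc hA] with y hy using negMulLog_mem_Icc hy)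

theorem entropyTerm_nonneg {A : Set Y} (hA : MeasurableSet A) : 0 ≤ entropyTerm ν A 𝒞 :=
  integral_nonneg_of_ae <| by
    filter_upwards [condProbOf_mem_Icc hA] with y hy using (negMulLog_mem_Icc hy).1

theorem entropyTerm_of_measurableSet (hm : 𝒞 ≤ mY) {A : Set Y} (hA : MeasurableSet[𝒞] A) :
    entropyTerm ν A 𝒞 = 0 := by
  have : condProbOf ν A 𝒞 = A.indicator fun _ => (1 : ℝ) :=
    condExp_of_stronglyMeasurable hm (stronglyMeasurable_const.indicator hA)
      (integrable_indicator_one (hm A hA))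
  rw [entropyTerm, this]
  convert integral_zero Y ℝ using 3 with y
  by_cases h : y ∈ A <;> simp [h]

theorem entropyTerm_empty (hm : 𝒞 ≤ mY) : entropyTerm ν ∅ 𝒞 = 0 :=
  entropyTerm_of_measurableSet hm (@MeasurableSet.empty _ 𝒞)

/-- Conditional Jensen for the concave function `negMulLog`, combined with the tower property. -/
theorem entropyTerm_anti (h : 𝒞 ≤ 𝒟) (hm : 𝒟 ≤ mY) {A : Set Y}
    (hA : MeasurableSet A) : entropyTerm ν A 𝒟 ≤ entropyTerm ν A 𝒞 := by
  have hj := Real.concaveOn_negMulLog.condExp_map_le (μ := ν) (h.trans hm)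
    (Real.continuous_negMulLog.upperSemicontinuous.upperSemicontinuousOn _)
    (f := condProbOf ν A 𝒟)
    (by filter_upwards [condProbOf_mem_Icc hA] with y hy using hy.1) isClosed_Ici
    integrable_condExp (integrable_negMulLog_condProbOf hA)
  have ht : ν[condProbOf ν A 𝒟 | 𝒞] =ᵐ[ν] condProbOf ν A 𝒞 := condExp_condExp_of_le h hm
  calc entropyTerm ν A 𝒟 = ∫ y, (ν[Real.negMulLog ∘ condProbOf ν A 𝒟 | 𝒞]) y ∂ν :=
        (integral_condExp (h.trans hm)).symm
    _ ≤ entropyTerm ν A 𝒞 := by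
        refine integral_mono_ae integrable_condExp (integrable_negMulLog_condProbOf hA) ?_
        filter_upwards [hj, ht] with y hy hy'
        rw [← hy']
        exact hy

/-- Apply `log s ≤ s - 1` to `s = 1 / √t` and multiply by `2 * t`. -/
theorem negMulLog_le_two_mul_sqrt {t : ℝ} (ht : 0 ≤ t) : Real.negMulLog t ≤ 2 * √t := by
  rcases ht.eq_or_lt with rfl | ht
  · simp
  have h1 := Real.log_le_sub_one_of_pos (x := (√t)⁻¹) (by positivity)
  rw [Real.log_inv, Real.log_sqrt ht.le] at h1
  have h3 : t * (√t)⁻¹ = √t := by rw [← div_eq_mul_inv, Real.div_sqrt]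
  have h4 := mul_le_mul_of_nonneg_left h1 ht.le
  rw [Real.negMulLog]
  linarith

/-- A set which is close to a `𝒞`-measurable set has a small entropy term. -/
theorem entropyTerm_le_sqrt (hm : 𝒞 ≤ mY) {A B : Set Y} (hA : MeasurableSet A)
    (hB : MeasurableSet[𝒞] B) : entropyTerm ν A 𝒞 ≤ 2 * √(ν.real (A ∆ B)) := by
  have hBm := hm B hB
  set f : Y → ℝ := fun y => |condProbOf ν A 𝒞 y - B.indicator (fun _ => (1 : ℝ)) y| with hf
  have hcB : condProbOf ν B 𝒞 = B.indicator fun _ => (1 : ℝ) :=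
    condExp_of_stronglyMeasurable hm (stronglyMeasurable_const.indicator hB)
      (integrable_indicator_one hBm)
  have hfi : Integrable f ν := (integrable_condExp.sub (integrable_indicator_one hBm)).abs
  have hf1 : ∀ᵐ y ∂ν, f y ∈ Set.Icc (0 : ℝ) 1 := by
    filter_upwards [condProbOf_mem_Icc (ν := ν) (𝒞 := 𝒞) hA] with y hy
    refine ⟨abs_nonneg _, abs_le.2 ?_⟩
    by_cases h : y ∈ B <;> simp [h] <;> constructor <;> linarith [hy.1, hy.2]
  -- Conditional expectation contracts the `L¹` norm, and `B` equals its own conditional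
  -- probability.
  have hfint : ∫ y, f y ∂ν ≤ ν.real (A ∆ B) := by
    have h1 : ν[(A.indicator fun _ => (1 : ℝ)) - B.indicator fun _ => (1 : ℝ) | 𝒞]
        =ᵐ[ν] condProbOf ν A 𝒞 - condProbOf ν B 𝒞 :=
      condExp_sub (integrable_indicator_one hA) (integrable_indicator_one hBm) 𝒞
    have h2 : ∫ y, f y ∂ν = ∫ y, |(ν[(A.indicator fun _ => (1 : ℝ)) -
        B.indicator fun _ => (1 : ℝ) | 𝒞]) y| ∂ν := by
      refine integral_congr_ae ?_
      filter_upwards [h1] with y hy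
      rw [hy, hf, hcB, Pi.sub_apply]
    rw [h2]
    refine (integral_abs_condExp_le _).trans (le_of_eq ?_)
    rw [← integral_indicator_one (hA.symmDiff hBm)]
    refine integral_congr_ae (Eventually.of_forall fun y => ?_)
    by_cases ha : y ∈ A <;> by_cases hb : y ∈ B <;> simp [ha, hb, Set.mem_symmDiff]
  -- Pointwise the integrand is at most `2 * √(f y)`: by the square-root bound off `B`, by `1 - t`
  -- on `B`. The inequality of means makes this linear in `f`; the optimal `δ` is the square root of
  -- the measure.
  have key : ∀ δ : ℝ, 0 < δ → entropyTerm ν A 𝒞 ≤ δ + ν.real (A ∆ B) / δ := by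
    intro δ hδ
    calc entropyTerm ν A 𝒞 ≤ ∫ y, (δ + f y / δ) ∂ν := by
          refine integral_mono_ae (integrable_negMulLog_condProbOf hA)
            ((integrable_const δ).add (hfi.div_const δ)) ?_
          filter_upwards [condProbOf_mem_Icc (ν := ν) (𝒞 := 𝒞) hA, hf1] with y hy hy1
          have hs : 2 * √(f y) ≤ δ + f y / δ := by
            have h0 := Real.sq_sqrt hy1.1
            have : 0 ≤ (√(f y) - δ) ^ 2 / δ := by positivity
            have h3 : (√(f y) - δ) ^ 2 / δ = δ + f y / δ - 2 * √(f y) := by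
              field_simp
              linear_combination h0
            linarith
          refine le_trans ?_ hs
          by_cases h : y ∈ B
          · have h1 : f y = 1 - condProbOf ν A 𝒞 y := by
              simp only [hf, h, Set.indicator_of_mem]
              rw [abs_sub_comm, abs_of_nonneg (by linarith [hy.2])]
            refine (Real.negMulLog_le_one_sub_self hy.1).trans ?_
            rw [← h1]
            have h2 : √(f y) ≤ 1 := Real.sqrt_le_one.2 hy1.2
            nlinarith [Real.mul_self_sqrt hy1.1, Real.sqrt_nonneg (f y)]
          · have h1 : f y = condProbOf ν A 𝒞 y := by
              simp only [hf, h, Set.indicator_of_notMem, not_false_eq_true, sub_zero]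
              rw [abs_of_nonneg hy.1]
            rw [h1]
            exact negMulLog_le_two_mul_sqrt hy.1
      _ = δ + (∫ y, f y ∂ν) / δ := by
          rw [integral_add (integrable_const δ) (hfi.div_const δ), integral_div]
          simp
      _ ≤ δ + ν.real (A ∆ B) / δ := by gcongr
  rcases (measureReal_nonneg (μ := ν) (s := A ∆ B)).eq_or_lt with h0 | h0
  · rw [← h0]
    simp only [Real.sqrt_zero, mul_zero]
    refine le_of_forall_pos_le_add fun δ hδ => ?_
    have := key δ hδ
    rw [← h0] at this
    simpa using this
  · have := key _ (Real.sqrt_pos.2 h0)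
    rw [Real.div_sqrt] at this
    linarith


/-- On `B` every other member of `β` leaves an empty trace, so the joined σ-algebra has the same
trace on `B` as `𝒞`. -/
theorem exists_measurable_eqOn_of_sup_generateFrom {β : Set (Set Y)} (hβ : β.PairwiseDisjoint id)
    {B : Set Y} (hB : B ∈ β) {g : Y → ℝ}
    (hg : Measurable[MeasurableSpace.generateFrom β ⊔ 𝒞] g) :
    ∃ k : Y → ℝ, Measurable[𝒞] k ∧ Set.EqOn g k B := by
  have hle : MeasurableSpace.comap (Subtype.val : B → Y) (MeasurableSpace.generateFrom β ⊔ 𝒞) ≤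
      MeasurableSpace.comap Subtype.val 𝒞 := by
    rw [MeasurableSpace.comap_sup, MeasurableSpace.comap_generateFrom]
    refine sup_le (MeasurableSpace.generateFrom_le ?_) le_rfl
    rintro _ ⟨C, hC, rfl⟩
    by_cases hCB : C = B
    · rw [hCB, Subtype.coe_preimage_self]
      exact @MeasurableSet.univ _ (MeasurableSpace.comap Subtype.val 𝒞)
    · rw [Set.preimage_eq_empty]
      · exact @MeasurableSet.empty _ (MeasurableSpace.comap Subtype.val 𝒞)
      · rw [Subtype.range_coe]
        exact hβ hC hB hCB
  have hgm : Measurable[MeasurableSpace.comap (Subtype.val : B → Y) 𝒞] fun y : B => g y :=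
    (hg.comp (comap_measurable Subtype.val)).mono hle le_rfl
  obtain ⟨k, hk, hgk⟩ := Measurable.exists_eq_measurable_comp (mY := 𝒞) hgm
  exact ⟨k, hk, fun y hy => congrFun hgk ⟨y, hy⟩⟩

/-- On a member `B` of `β`, conditioning on `σ(β) ∨ 𝒞` is conditioning on `B` and on `𝒞`. -/
theorem exists_condProbOf_sup_generateFrom (hm : 𝒞 ≤ mY) {β : Set (Set Y)}
    (hβ : IsFinitePartition β) {B : Set Y} (hB : B ∈ β) {A : Set Y} (hA : MeasurableSet A) :
    ∃ k : Y → ℝ, Measurable[𝒞] k ∧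
      Set.EqOn (condProbOf ν A (MeasurableSpace.generateFrom β ⊔ 𝒞)) k B ∧
      condProbOf ν (A ∩ B) 𝒞 =ᵐ[ν] condProbOf ν B 𝒞 * k := by
  have hBm := hβ.measurableSet B hB
  have h𝒟 : MeasurableSpace.generateFrom β ⊔ 𝒞 ≤ mY :=
    sup_le (MeasurableSpace.generateFrom_le hβ.measurableSet) hm
  have hB𝒟 : MeasurableSet[MeasurableSpace.generateFrom β ⊔ 𝒞] B :=
    (le_sup_left : MeasurableSpace.generateFrom β ≤ _) B (MeasurableSpace.measurableSet_generateFrom hB)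
  obtain ⟨k, hk, hgk⟩ := exists_measurable_eqOn_of_sup_generateFrom (𝒞 := 𝒞)
    hβ.pairwiseDisjoint hB
    (stronglyMeasurable_condExp (μ := ν) (f := A.indicator fun _ => (1 : ℝ))).measurable
  refine ⟨k, hk, hgk, ?_⟩
  set g := condProbOf ν A (MeasurableSpace.generateFrom β ⊔ 𝒞) with hg
  have hkg : (B.indicator fun _ => (1 : ℝ)) * k = B.indicator g := by
    ext y
    by_cases hy : y ∈ B <;> simp [hy]
    exact (hgk hy).symm
  -- Nothing bounds `k` off `B`; integrability comes from its agreement with `g` on `B`.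
  have hint : Integrable ((B.indicator fun _ => (1 : ℝ)) * k) ν := by
    rw [hkg]
    exact integrable_condExp.indicator hBm
  have h1 : ν[(B.indicator fun _ => (1 : ℝ)) * k | 𝒞] =ᵐ[ν] condProbOf ν B 𝒞 * k :=
    condExp_mul_of_aestronglyMeasurable_right hk.stronglyMeasurable.aestronglyMeasurable hint
      (integrable_indicator_one hBm)
  have h2 : condProbOf ν (A ∩ B) (MeasurableSpace.generateFrom β ⊔ 𝒞) =ᵐ[ν] B.indicator g := by
    have := condExp_indicator (m := MeasurableSpace.generateFrom β ⊔ 𝒞)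
      (integrable_indicator_one (ν := ν) hA) hB𝒟
    rwa [Set.indicator_indicator, Set.inter_comm] at this
  calc condProbOf ν (A ∩ B) 𝒞
      =ᵐ[ν] ν[condProbOf ν (A ∩ B) (MeasurableSpace.generateFrom β ⊔ 𝒞) | 𝒞] :=
        (condExp_condExp_of_le le_sup_right h𝒟).symm
    _ =ᵐ[ν] ν[B.indicator g | 𝒞] := condExp_congr_ae h2
    _ = ν[(B.indicator fun _ => (1 : ℝ)) * k | 𝒞] := by rw [hkg]
    _ =ᵐ[ν] condProbOf ν B 𝒞 * k := h1

theorem sum_condProbOf_inter {α : Finset (Set Y)} (hα : IsFinitePartition (α : Set (Set Y)))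
    {B : Set Y} (hB : MeasurableSet B) :
    condProbOf ν B 𝒞 =ᵐ[ν] ∑ A ∈ α, condProbOf ν (A ∩ B) 𝒞 := by
  have h : (B.indicator fun _ => (1 : ℝ)) = ∑ A ∈ α, (A ∩ B).indicator fun _ => (1 : ℝ) := by
    ext y
    obtain ⟨A, hA, hyA⟩ := Set.mem_sUnion.1 (hα.sUnion_eq.symm ▸ Set.mem_univ y)
    rw [Finset.sum_apply, Finset.sum_eq_single_of_mem A hA]
    · by_cases hy : y ∈ B <;> simp [hy, hyA]
    · intro A' hA' hne
      refine Set.indicator_of_notMem (fun hy => ?_) _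
      exact Set.disjoint_left.1 (hα.pairwiseDisjoint hA' hA hne) hy.1 hyA
  rw [condProbOf, h]
  exact condExp_finsetSum (fun A hA =>
    integrable_indicator_one ((hα.measurableSet A hA).inter hB)) 𝒞

/-- With `P(A ∩ B | 𝒞) = P(B | 𝒞) * k A`, the product rule for `negMulLog` yields `k A * negMulLog
P(B | 𝒞)` plus `P(B | 𝒞) * negMulLog (k A)`. The second part integrates to the integral over `B` on
the left; the first sums to the term of `B`, as the `k A` add up to `1` wherever `P(B | 𝒞)` is
nonzero. -/
theorem sum_setIntegral_condProbOf (hm : 𝒞 ≤ mY) {β : Set (Set Y)} (hβ : IsFinitePartition β)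
    {α : Finset (Set Y)} (hα : IsFinitePartition (α : Set (Set Y))) {B : Set Y} (hB : B ∈ β) :
    ∑ A ∈ α, ∫ y in B, Real.negMulLog
        (condProbOf ν A (MeasurableSpace.generateFrom β ⊔ 𝒞) y) ∂ν =
      ∑ A ∈ α, entropyTerm ν (A ∩ B) 𝒞 - entropyTerm ν B 𝒞 := by
  have hBm := hβ.measurableSet B hB
  have hex : ∀ A ∈ α, ∃ k : Y → ℝ, Measurable[𝒞] k ∧
      Set.EqOn (condProbOf ν A (MeasurableSpace.generateFrom β ⊔ 𝒞)) k B ∧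
      condProbOf ν (A ∩ B) 𝒞 =ᵐ[ν] condProbOf ν B 𝒞 * k := fun A hA =>
    exists_condProbOf_sup_generateFrom hm hβ hB (hα.measurableSet A hA)
  choose! k hk hkB hkm using hex
  have hstep : ∀ A ∈ α,
      Integrable (fun y => k A y * Real.negMulLog (condProbOf ν B 𝒞 y)) ν ∧
      ∫ y in B, Real.negMulLog
        (condProbOf ν A (MeasurableSpace.generateFrom β ⊔ 𝒞) y) ∂ν =
      entropyTerm ν (A ∩ B) 𝒞 - ∫ y, k A y * Real.negMulLog (condProbOf ν B 𝒞 y) ∂ν := by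
    intro A hA
    have hAm := hα.measurableSet A hA
    have hkη : Measurable[𝒞] fun y => Real.negMulLog (k A y) :=
      Real.continuous_negMulLog.measurable.comp (hk A hA)
    have he : (B.indicator fun _ => (1 : ℝ)) * (fun y => Real.negMulLog (k A y)) =
        B.indicator fun y => Real.negMulLog
          (condProbOf ν A (MeasurableSpace.generateFrom β ⊔ 𝒞) y) := by
      ext y
      by_cases hy : y ∈ B <;> simp [hy]
      rw [← hkB A hA hy]
    have hi : Integrable ((B.indicator fun _ => (1 : ℝ)) * fun y => Real.negMulLog (k A y)) ν := by
      rw [he]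
      exact (integrable_negMulLog_condProbOf hAm).indicator hBm
    have h1 : ν[(B.indicator fun _ => (1 : ℝ)) * fun y => Real.negMulLog (k A y) | 𝒞] =ᵐ[ν]
        condProbOf ν B 𝒞 * fun y => Real.negMulLog (k A y) :=
      condExp_mul_of_aestronglyMeasurable_right
        hkη.stronglyMeasurable.aestronglyMeasurable hi (integrable_indicator_one hBm)
    have h2 : (condProbOf ν B 𝒞 * fun y => Real.negMulLog (k A y)) =ᵐ[ν] fun y =>
        Real.negMulLog (condProbOf ν (A ∩ B) 𝒞 y) -
          k A y * Real.negMulLog (condProbOf ν B 𝒞 y) := by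
      filter_upwards [hkm A hA] with y hy
      rw [hy, Pi.mul_apply, Pi.mul_apply, Real.negMulLog_mul]
      ring
    have hi1 : Integrable (condProbOf ν B 𝒞 * fun y => Real.negMulLog (k A y)) ν :=
      integrable_condExp.congr h1
    have hi2 := integrable_negMulLog_condProbOf (ν := ν) (𝒞 := 𝒞) (hAm.inter hBm)
    have hi3 : Integrable (fun y => k A y * Real.negMulLog (condProbOf ν B 𝒞 y)) ν := by
      refine (hi2.sub hi1).congr ?_
      filter_upwards [h2] with y hy
      rw [Pi.sub_apply, hy]
      ring
    refine ⟨hi3, ?_⟩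
    rw [← integral_indicator hBm, ← he, ← integral_condExp hm, integral_congr_ae (h1.trans h2),
      integral_sub hi2 hi3]
    rfl
  rw [Finset.sum_congr rfl fun A hA => (hstep A hA).2, Finset.sum_sub_distrib,
    ← integral_finsetSum _ fun A hA => (hstep A hA).1]
  congr 1
  refine integral_congr_ae ?_
  have hall : ∀ᵐ y ∂ν, ∀ A ∈ α, condProbOf ν (A ∩ B) 𝒞 y = condProbOf ν B 𝒞 y * k A y :=
    (ae_ball_iff α.countable_toSet).2 hkm
  filter_upwards [hall, sum_condProbOf_inter (ν := ν) (𝒞 := 𝒞) hα hBm] with y hy hs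
  rw [← Finset.sum_mul]
  rw [Finset.sum_apply, Finset.sum_congr rfl fun A hA => hy A hA, ← Finset.mul_sum] at hs
  -- Where `P(B | 𝒞)` vanishes the sum of the `k A` is unknown, but there both sides are zero.
  by_cases h0 : condProbOf ν B 𝒞 y = 0
  · simp [h0]
  · rw [mul_eq_left₀ h0 |>.1 hs.symm, one_mul]

/-- The chain rule `∑ H(A ∩ B | 𝒞) = H(β | 𝒞) + H(α | σ(β) ∨ 𝒞)`. -/
theorem sum_entropyTerm_inter (hm : 𝒞 ≤ mY) {α β : Finset (Set Y)}
    (hα : IsFinitePartition (α : Set (Set Y))) (hβ : IsFinitePartition (β : Set (Set Y))) :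
    ∑ B ∈ β, ∑ A ∈ α, entropyTerm ν (A ∩ B) 𝒞 = ∑ B ∈ β, entropyTerm ν B 𝒞 +
      ∑ A ∈ α, entropyTerm ν A (MeasurableSpace.generateFrom β ⊔ 𝒞) := by
  have h : ∀ A ∈ α, entropyTerm ν A (MeasurableSpace.generateFrom (β : Set (Set Y)) ⊔ 𝒞) =
      ∑ B ∈ β, ∫ y in B, Real.negMulLog
        (condProbOf ν A (MeasurableSpace.generateFrom (β : Set (Set Y)) ⊔ 𝒞) y) ∂ν := by
    intro A hA
    have hi := integrable_negMulLog_condProbOf (ν := ν)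
      (𝒞 := MeasurableSpace.generateFrom (β : Set (Set Y)) ⊔ 𝒞) (hα.measurableSet A hA)
    have := integral_biUnion_finset (μ := ν) β (s := id) hβ.measurableSet hβ.pairwiseDisjoint
      (fun B _ => hi.integrableOn)
    simp only [id] at this
    rw [← this]
    have hu : ⋃ B ∈ β, B = Set.univ := by rw [← hβ.sUnion_eq, Set.sUnion_eq_biUnion]; rfl
    rw [hu, setIntegral_univ]
    rfl
  rw [Finset.sum_congr rfl h, Finset.sum_comm (s := α) (t := β),
    Finset.sum_congr rfl fun B hB => sum_setIntegral_condProbOf hm hβ hα hB,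
    Finset.sum_sub_distrib]
  ring

end ConditionalEntropy

/-! ### Conditional entropy of finite partitions. -/

section FinitePartitions

variable {Y : Type*} {𝒞 𝒟 : MeasurableSpace Y} {mY : MeasurableSpace Y}

theorem IsFinitePartition.image2_inter {α β : Set (Set Y)} (hα : IsFinitePartition α)
    (hβ : IsFinitePartition β) : IsFinitePartition (Set.image2 (· ∩ ·) α β) where
  finite := hα.finite.image2 _ hβ.finite
  measurableSet := by
    rintro _ ⟨A, hA, B, hB, rfl⟩
    exact (hα.measurableSet A hA).inter (hβ.measurableSet B hB)
  sUnion_eq := by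
    refine Set.eq_univ_of_forall fun y => ?_
    obtain ⟨A, hA, hyA⟩ := Set.mem_sUnion.1 (hα.sUnion_eq.symm ▸ Set.mem_univ y)
    obtain ⟨B, hB, hyB⟩ := Set.mem_sUnion.1 (hβ.sUnion_eq.symm ▸ Set.mem_univ y)
    exact ⟨A ∩ B, ⟨A, hA, B, hB, rfl⟩, hyA, hyB⟩
  pairwiseDisjoint := by
    rintro _ ⟨A, hA, B, hB, rfl⟩ _ ⟨A', hA', B', hB', rfl⟩ hne
    refine Set.disjoint_left.2 fun y hy hy' => hne ?_
    have h1 : A = A' := hα.pairwiseDisjoint.elim_set hA hA' y hy.1 hy'.1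
    have h2 : B = B' := hβ.pairwiseDisjoint.elim_set hB hB' y hy.2 hy'.2
    rw [h1, h2]

theorem isFinitePartition_singleton_univ : IsFinitePartition ({Set.univ} : Set (Set Y)) where
  finite := Set.finite_singleton _
  measurableSet := by simp
  sUnion_eq := by simp
  pairwiseDisjoint := by simp

theorem IsFinitePartition.generateFrom_le {α : Set (Set Y)} (hα : IsFinitePartition α) :
    MeasurableSpace.generateFrom α ≤ mY :=
  MeasurableSpace.generateFrom_le hα.measurableSet

theorem generateFrom_image2_inter {α β : Set (Set Y)} (hα : IsFinitePartition α)
    (hβ : IsFinitePartition β) :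
    MeasurableSpace.generateFrom (Set.image2 (· ∩ ·) α β) =
      MeasurableSpace.generateFrom α ⊔ MeasurableSpace.generateFrom β := by
  refine le_antisymm (MeasurableSpace.generateFrom_le ?_) (sup_le ?_ ?_)
  · rintro _ ⟨A, hA, B, hB, rfl⟩
    exact MeasurableSet.inter
      ((le_sup_left : MeasurableSpace.generateFrom α ≤ _) A
        (MeasurableSpace.measurableSet_generateFrom hA))
      ((le_sup_right : MeasurableSpace.generateFrom β ≤ _) B
        (MeasurableSpace.measurableSet_generateFrom hB))
  · refine MeasurableSpace.generateFrom_le fun A hA => ?_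
    have : A = ⋃ B ∈ β, A ∩ B := by
      rw [← Set.inter_iUnion₂, ← Set.sUnion_eq_biUnion, hβ.sUnion_eq, Set.inter_univ]
    rw [this]
    exact MeasurableSet.biUnion hβ.finite.countable fun B hB =>
      MeasurableSpace.measurableSet_generateFrom ⟨A, hA, B, hB, rfl⟩
  · refine MeasurableSpace.generateFrom_le fun B hB => ?_
    have : B = ⋃ A ∈ α, A ∩ B := by
      rw [← Set.iUnion₂_inter, ← Set.sUnion_eq_biUnion, hα.sUnion_eq, Set.univ_inter]
    rw [this]
    exact MeasurableSet.biUnion hα.finite.countable fun A hA =>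
      MeasurableSpace.measurableSet_generateFrom ⟨A, hA, B, hB, rfl⟩

variable {ν : Measure Y} [IsProbabilityMeasure ν]

theorem condEntropy_nonneg {α : Set (Set Y)} (hα : IsFinitePartition α) :
    0 ≤ condEntropy ν α 𝒞 := by
  rw [condEntropy_eq_sum hα.finite]
  exact Finset.sum_nonneg fun A hA =>
    entropyTerm_nonneg (hα.measurableSet A (hα.finite.mem_toFinset.1 hA))

theorem condEntropy_anti (h : 𝒞 ≤ 𝒟) (hm : 𝒟 ≤ mY) {α : Set (Set Y)}
    (hα : IsFinitePartition α) : condEntropy ν α 𝒟 ≤ condEntropy ν α 𝒞 := by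
  rw [condEntropy_eq_sum hα.finite, condEntropy_eq_sum hα.finite]
  exact Finset.sum_le_sum fun A hA =>
    entropyTerm_anti h hm (hα.measurableSet A (hα.finite.mem_toFinset.1 hA))

theorem condEntropy_eq_zero (hm : 𝒞 ≤ mY) {α : Set (Set Y)} (hα : α.Finite)
    (h : ∀ A ∈ α, MeasurableSet[𝒞] A) : condEntropy ν α 𝒞 = 0 := by
  rw [condEntropy_eq_sum hα]
  exact Finset.sum_eq_zero fun A hA =>
    entropyTerm_of_measurableSet hm (h A (hα.mem_toFinset.1 hA))

/-- The chain rule `H(α ∨ β | 𝒞) = H(β | 𝒞) + H(α | σ(β) ∨ 𝒞)`. -/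
theorem condEntropy_image2_inter (hm : 𝒞 ≤ mY) {α β : Set (Set Y)} (hα : IsFinitePartition α)
    (hβ : IsFinitePartition β) :
    condEntropy ν (Set.image2 (· ∩ ·) α β) 𝒞 =
      condEntropy ν β 𝒞 + condEntropy ν α (MeasurableSpace.generateFrom β ⊔ 𝒞) := by
  classical
  obtain ⟨a, rfl⟩ := hα.finite.exists_finset_coe
  obtain ⟨b, rfl⟩ := hβ.finite.exists_finset_coe
  rw [condEntropy_eq_sum (hα.image2_inter hβ).finite, condEntropy_eq_sum hα.finite,
    condEntropy_eq_sum hβ.finite]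
  simp only [Finset.finite_toSet_toFinset]
  rw [← sum_entropyTerm_inter hm hα hβ, ← Finset.sum_product']
  have h : (hα.image2_inter hβ).finite.toFinset =
      (b ×ˢ a).image fun p : Set Y × Set Y => p.2 ∩ p.1 := by
    ext S
    simp only [Set.Finite.mem_toFinset, Set.mem_image2, Finset.mem_coe, Finset.mem_image,
      Finset.mem_product, Prod.exists]
    constructor
    · rintro ⟨A, hA, B, hB, rfl⟩
      exact ⟨B, A, ⟨hB, hA⟩, rfl⟩
    · rintro ⟨B, A, ⟨hB, hA⟩, rfl⟩
      exact ⟨A, hA, B, hB, rfl⟩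
  -- Different pairs can share an intersection only when it is empty, and the empty set contributes
  -- zero.
  rw [h, Finset.sum_image_of_disjoint (g := fun A => entropyTerm ν A 𝒞) (entropyTerm_empty hm)]
  rintro ⟨B, A⟩ h1 ⟨B', A'⟩ h2 hne
  rw [Finset.mem_coe, Finset.mem_product] at h1 h2
  refine Set.disjoint_left.2 fun y hy hy' => hne ?_
  exact Prod.ext (hβ.pairwiseDisjoint.elim_set h1.1 h2.1 y hy.2 hy'.2)
    (hα.pairwiseDisjoint.elim_set h1.2 h2.2 y hy.1 hy'.1)

theorem condEntropy_image2_inter_le (hm : 𝒞 ≤ mY) {α β : Set (Set Y)}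
    (hα : IsFinitePartition α) (hβ : IsFinitePartition β) :
    condEntropy ν (Set.image2 (· ∩ ·) α β) 𝒞 ≤ condEntropy ν α 𝒞 + condEntropy ν β 𝒞 := by
  rw [condEntropy_image2_inter hm hα hβ, add_comm]
  gcongr
  exact condEntropy_anti le_sup_right (sup_le hβ.generateFrom_le hm) hα

/-- `H(α | 𝒞) ≤ H(β | 𝒞) + H(α | σ(β) ∨ 𝒞)`. -/
theorem condEntropy_le_add (hm : 𝒞 ≤ mY) {α β : Set (Set Y)} (hα : IsFinitePartition α)
    (hβ : IsFinitePartition β) :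
    condEntropy ν α 𝒞 ≤
      condEntropy ν β 𝒞 + condEntropy ν α (MeasurableSpace.generateFrom β ⊔ 𝒞) := by
  rw [← condEntropy_image2_inter hm hα hβ, Set.image2_comm (g := (· ∩ ·)) Set.inter_comm,
    condEntropy_image2_inter hm hβ hα]
  exact le_add_of_nonneg_right (condEntropy_nonneg hβ)

theorem IsFinitePartition.preimage {α : Set (Set Y)} (hα : IsFinitePartition α) {T : Y → Y}
    (hT : Measurable T) : IsFinitePartition ((T ⁻¹' ·) '' α) where
  finite := hα.finite.image _
  measurableSet := by
    rintro _ ⟨A, hA, rfl⟩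
    exact hT (hα.measurableSet A hA)
  sUnion_eq := by
    rw [Set.sUnion_image, ← Set.preimage_iUnion₂, ← Set.sUnion_eq_biUnion, hα.sUnion_eq,
      Set.preimage_univ]
  pairwiseDisjoint := by
    rintro _ ⟨A, hA, rfl⟩ _ ⟨A', hA', rfl⟩ hne
    exact (hα.pairwiseDisjoint hA hA' fun h => hne (by rw [h])).preimage T

/-- Both sides have equal integrals over every `T ⁻¹' S` with `S` in `𝒞`, and these sets make up the
pulled-back σ-algebra. -/
theorem condProbOf_preimage (hm : 𝒞 ≤ mY) {T : Y → Y} (hT : MeasurePreserving T ν ν) {A : Set Y}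
    (hA : MeasurableSet A) :
    condProbOf ν (T ⁻¹' A) (MeasurableSpace.comap T 𝒞) =ᵐ[ν] condProbOf ν A 𝒞 ∘ T := by
  have hmT : MeasurableSpace.comap T 𝒞 ≤ mY :=
    (MeasurableSpace.comap_mono hm).trans hT.measurable.comap_le
  have hi : Integrable (condProbOf ν A 𝒞) ν := integrable_condExp
  have hsm : StronglyMeasurable[𝒞] (condProbOf ν A 𝒞) := stronglyMeasurable_condExp
  refine (ae_eq_condExp_of_forall_setIntegral_eq hmT
    (integrable_indicator_one (hT.measurable hA))
    (fun s _ _ => (hT.integrable_comp_of_integrable hi).integrableOn) ?_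
    (hsm.comp_measurable (comap_measurable T)).aestronglyMeasurable).symm
  rintro _ ⟨S, hS, rfl⟩ -
  have hSm := hm S hS
  have h1 : ∀ f : Y → ℝ, AEStronglyMeasurable f ν →
      ∫ x in T ⁻¹' S, f (T x) ∂ν = ∫ x in S, f x ∂ν := by
    intro f hf
    have := setIntegral_map (μ := ν) hSm (hT.map_eq.symm ▸ hf) hT.measurable.aemeasurable
    rw [← this, hT.map_eq]
  have h2 : ((T ⁻¹' A).indicator fun _ => (1 : ℝ)) =
      fun x => (A.indicator fun _ => (1 : ℝ)) (T x) := rfl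
  rw [h2, h1 _ (integrable_indicator_one hA).aestronglyMeasurable]
  exact (h1 _ hi.aestronglyMeasurable).trans (setIntegral_condExp hm (integrable_indicator_one hA) hS)

theorem entropyTerm_preimage (hm : 𝒞 ≤ mY) {T : Y → Y} (hT : MeasurePreserving T ν ν) {A : Set Y}
    (hA : MeasurableSet A) :
    entropyTerm ν (T ⁻¹' A) (MeasurableSpace.comap T 𝒞) = entropyTerm ν A 𝒞 := by
  have h : AEStronglyMeasurable (fun y => Real.negMulLog (condProbOf ν A 𝒞 y)) (ν.map T) := by
    rw [hT.map_eq]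
    exact (integrable_negMulLog_condProbOf hA).aestronglyMeasurable
  have h' := integral_map hT.measurable.aemeasurable h
  rw [hT.map_eq] at h'
  rw [entropyTerm, entropyTerm, h']
  refine integral_congr_ae ?_
  filter_upwards [condProbOf_preimage hm hT hA] with y hy
  rw [hy, Function.comp_apply]

/-- Surjectivity of `T` keeps the preimages of different members different, so no term of the sum is
lost. -/
theorem condEntropy_preimage (hm : 𝒞 ≤ mY) {T : Y → Y} (hT : MeasurePreserving T ν ν)
    (hs : Function.Surjective T) {α : Set (Set Y)} (hα : IsFinitePartition α) :
    condEntropy ν ((T ⁻¹' ·) '' α) (MeasurableSpace.comap T 𝒞) = condEntropy ν α 𝒞 := by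
  classical
  rw [condEntropy_eq_sum (hα.finite.image _), condEntropy_eq_sum hα.finite,
    Set.Finite.toFinset_image _ hα.finite, Finset.sum_image (hs.preimage_injective.injOn)]
  exact Finset.sum_congr rfl fun A hA =>
    entropyTerm_preimage hm hT (hα.measurableSet A (hα.finite.mem_toFinset.1 hA))

end FinitePartitions

/-! ### Følner limits of submodular set functions. -/

section SubmodularLimit

variable {G : Type*} [DecidableEq G]

/-- Shearer's inequality for monotone submodular set functions. -/
theorem card_mul_le_sum_of_submodular {ι : Type*} {φ : Finset G → ℝ} (h0 : φ ∅ = 0)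
    (hmono : Monotone φ)
    (hsub : ∀ S K : Finset G, S ⊆ K → ∀ g ∉ K,
      φ (insert g K) - φ K ≤ φ (insert g S) - φ S)
    (I : Finset ι) (T : ι → Finset G) (k : ℕ) (K : Finset G)
    (hk : ∀ g ∈ K, k ≤ (I.filter fun i => g ∈ T i).card) :
    k * φ K ≤ ∑ i ∈ I, φ (T i) := by
  -- Cutting each `T i` down to `K` allows induction on `K`, one element at a time.
  have key : ∀ K : Finset G, (∀ g ∈ K, k ≤ (I.filter fun i => g ∈ T i).card) →
      k * φ K ≤ ∑ i ∈ I, φ (T i ∩ K) := by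
    intro K
    induction K using Finset.induction_on with
    | empty => simp [h0]
    | insert g K hg ih =>
      intro hK
      have h1 := ih fun x hx => hK x (Finset.mem_insert_of_mem hx)
      have hd : 0 ≤ φ (insert g K) - φ K := sub_nonneg.2 (hmono (Finset.subset_insert _ _))
      -- By submodularity, inserting `g` into `T i ∩ K` gains at least as much as inserting it into
      -- `K`; this happens for at least `k` indices.
      have h2 : ∀ i ∈ I, (if g ∈ T i then φ (insert g K) - φ K else 0) ≤
          φ (T i ∩ insert g K) - φ (T i ∩ K) := by
        intro i _
        split_ifs with hi
        · rw [Finset.inter_insert_of_mem hi]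
          exact hsub _ _ Finset.inter_subset_right g hg
        · rw [Finset.inter_insert_of_notMem hi, sub_self]
      have h3 := Finset.sum_le_sum h2
      rw [← Finset.sum_filter, Finset.sum_const, nsmul_eq_mul, Finset.sum_sub_distrib] at h3
      have h4 : (k : ℝ) ≤ ((I.filter fun i => g ∈ T i).card : ℝ) :=
        Nat.cast_le.2 (hK g (Finset.mem_insert_self _ _))
      nlinarith [mul_le_mul_of_nonneg_right h4 hd]
  exact (key K hk).trans (Finset.sum_le_sum fun i _ => hmono Finset.inter_subset_left)

variable [Group G]

/-- The translates `T i`, with `i` in `T⁻¹ K`, cover each `g` in `K` at least `|T|` times, through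
`i = t⁻¹ g`. Shearer's inequality applies, and all translates have the same value of `φ`. -/
theorem card_mul_le_card_mul_of_submodular {φ : Finset G → ℝ} (h0 : φ ∅ = 0)
    (hmono : Monotone φ)
    (hsub : ∀ S K : Finset G, S ⊆ K → ∀ g ∉ K,
      φ (insert g K) - φ K ≤ φ (insert g S) - φ S)
    (hinv : ∀ (K : Finset G) (h : G), φ (K.image (· * h)) = φ K) (T K : Finset G) :
    T.card * φ K ≤ (Finset.image₂ (fun t f => t⁻¹ * f) T K).card * φ T := by
  have h := card_mul_le_sum_of_submodular h0 hmono hsub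
    (Finset.image₂ (fun t f => t⁻¹ * f) T K) (fun i => T.image (· * i)) T.card K ?_
  · simpa only [hinv, Finset.sum_const, nsmul_eq_mul] using h
  · intro g hg
    have hinj : Set.InjOn (fun t : G => t⁻¹ * g) T := fun a _ b _ hab => by simpa using hab
    rw [← Finset.card_image_of_injOn hinj]
    refine Finset.card_le_card fun x hx => ?_
    obtain ⟨t, ht, rfl⟩ := Finset.mem_image.1 hx
    refine Finset.mem_filter.2 ⟨Finset.mem_image₂_of_mem ht hg, ?_⟩
    exact Finset.mem_image.2 ⟨t, ht, by simp⟩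

/-- A point `t⁻¹ f` outside `K` lies in the symmetric difference of `t⁻¹ K` and `K`; for a Følner
set these differences are relatively small. -/
theorem card_image₂_inv_mul_le (T K : Finset G) :
    ((Finset.image₂ (fun t f => t⁻¹ * f) T K).card : ℝ) ≤
      K.card + ∑ t ∈ T, ((symmDiff ((fun h => t⁻¹ * h) '' (K : Set G)) (K : Set G)).ncard : ℝ) := by
  have h1 : ∀ t : G, (symmDiff ((fun h => t⁻¹ * h) '' (K : Set G)) (K : Set G)).ncard =
      (symmDiff (K.image fun h => t⁻¹ * h) K).card := by
    intro t
    rw [← Set.ncard_coe_finset, Finset.coe_symmDiff, Finset.coe_image]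
  simp only [h1]
  have h2 : Finset.image₂ (fun t f => t⁻¹ * f) T K ⊆
      K ∪ T.biUnion fun t => symmDiff (K.image fun h => t⁻¹ * h) K := by
    intro x hx
    obtain ⟨t, ht, f, hf, rfl⟩ := Finset.mem_image₂.1 hx
    by_cases hK : t⁻¹ * f ∈ K
    · exact Finset.mem_union_left _ hK
    · refine Finset.mem_union_right _ (Finset.mem_biUnion.2 ⟨t, ht, ?_⟩)
      exact Finset.mem_symmDiff.2 (Or.inl ⟨Finset.mem_image_of_mem _ hf, hK⟩)
  exact_mod_cast (Finset.card_le_card h2).trans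
    ((Finset.card_union_le _ _).trans (Nat.add_le_add_left Finset.card_biUnion_le _))

/-- For a monotone submodular set function `φ` which is invariant under right translations,
`φ (Φ n) / |Φ n|` converges to the infimum of `φ T / |T|` along every Følner sequence. -/
theorem IsFolnerSequence.tendsto_of_submodular {φ : Finset G → ℝ} (h0 : φ ∅ = 0)
    (hmono : Monotone φ)
    (hsub : ∀ S K : Finset G, S ⊆ K → ∀ g ∉ K,
      φ (insert g K) - φ K ≤ φ (insert g S) - φ S)
    (hinv : ∀ (K : Finset G) (h : G), φ (K.image (· * h)) = φ K)
    {Φ : ℕ → Finset G} (hΦ : IsFolnerSequence Φ) :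
    Tendsto (fun n => φ (Φ n) / (Φ n).card) atTop
      (𝓝 (⨅ T : {T : Finset G // T.Nonempty}, φ T / (T.1.card : ℝ))) := by
  have hnn : ∀ K, 0 ≤ φ K := fun K => h0 ▸ hmono (Finset.empty_subset K)
  have hbdd : BddBelow (Set.range fun T : {T : Finset G // T.Nonempty} =>
      φ T / (T.1.card : ℝ)) :=
    ⟨0, by rintro _ ⟨T, rfl⟩; exact div_nonneg (hnn _) (Nat.cast_nonneg _)⟩
  have hpos : ∀ T : Finset G, T.Nonempty → (0 : ℝ) < T.card := fun T hT =>
    Nat.cast_pos.2 hT.card_pos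
  have : Nonempty {T : Finset G // T.Nonempty} := ⟨⟨{1}, Finset.singleton_nonempty 1⟩⟩
  -- The infimum is a lower bound for every term; only the upper bound uses the Følner property,
  -- with a nearly optimal `T`.
  refine tendsto_order.2 ⟨fun c hc => Eventually.of_forall fun n =>
    hc.trans_le (ciInf_le hbdd ⟨Φ n, hΦ.1 n⟩), fun c hc => ?_⟩
  obtain ⟨⟨T, hT⟩, hTc⟩ := exists_lt_of_ciInf_lt hc
  have hlim : Tendsto (fun n => φ T / T.card * (1 + ∑ t ∈ T,
      ((symmDiff ((fun h => t⁻¹ * h) '' (Φ n : Set G)) (Φ n : Set G)).ncard : ℝ) / (Φ n).card))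
      atTop (𝓝 (φ T / T.card)) := by
    have := (tendsto_finsetSum T fun t _ => hΦ.2 t⁻¹).const_add (1 : ℝ) |>.const_mul
      (φ T / T.card)
    simpa using this
  filter_upwards [hlim.eventually_lt_const hTc] with n hn
  refine lt_of_le_of_lt ?_ hn
  have hc1 := hpos _ (hΦ.1 n)
  have hc2 := hpos _ hT
  have h1 := card_mul_le_card_mul_of_submodular h0 hmono hsub hinv T (Φ n)
  have h2 := mul_le_mul_of_nonneg_right (card_image₂_inv_mul_le T (Φ n)) (hnn T)
  rw [← Finset.sum_div, ← div_self hc1.ne', ← add_div, div_mul_div_comm,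
    div_le_div_iff₀ hc1 (mul_pos hc2 hc1)]
  nlinarith [mul_le_mul_of_nonneg_right (h1.trans h2) hc1.le]

end SubmodularLimit

/-! ### Fiber entropy of a bundle, and why excellent covers are good. -/

namespace ContinuousBundleRDS

variable {G Ω X : Type*} [Group G] [MulAction G Ω] [MeasurableSpace Ω] {P : Measure Ω}
  [MetricSpace X] [MeasurableSpace X]

theorem measurable_base (F : ContinuousBundleRDS G P X) : Measurable fun p : F.E => p.1.1 :=
  measurable_fst.comp measurable_subtype_coe

theorem baseAlgebra_le (F : ContinuousBundleRDS G P X) :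
    F.baseAlgebra ≤ (inferInstance : MeasurableSpace F.E) :=
  F.measurable_base.comap_le

theorem HasMarginal.isProbabilityMeasure [IsProbabilityMeasure P] {F : ContinuousBundleRDS G P X}
    {μ : Measure F.E} (h : F.HasMarginal μ) : IsProbabilityMeasure μ := by
  have h1 : μ.map (fun p : F.E => p.1.1) Set.univ = 1 := by rw [h, measure_univ]
  rw [Measure.map_apply F.measurable_base MeasurableSet.univ] at h1
  exact ⟨h1⟩

theorem skew_skew (F : ContinuousBundleRDS G P X) (g₂ g₁ : G) (p : F.E) :
    F.skew g₂ (F.skew g₁ p) = F.skew (g₂ * g₁) p :=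
  Subtype.ext (Prod.ext (mul_smul _ _ _).symm (F.map_map g₁ g₂ p))

theorem skew_one (F : ContinuousBundleRDS G P X) (p : F.E) : F.skew 1 p = p :=
  Subtype.ext (Prod.ext (one_smul _ _) (F.map_one p))

theorem skew_surjective (F : ContinuousBundleRDS G P X) (g : G) :
    Function.Surjective (F.skew g) := fun p =>
  ⟨F.skew g⁻¹ p, by rw [skew_skew, mul_inv_cancel, skew_one]⟩

theorem measurable_skew [MeasurableConstSMul G Ω] (F : ContinuousBundleRDS G P X) (g : G) :
    Measurable (F.skew g) :=
  ((F.measurable_base.const_smul g).prodMk (F.measurable_map g)).subtype_mk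

/-- The base action is invertible, so conditioning on the base is unaffected by translation. -/
theorem comap_skew_baseAlgebra [MeasurableConstSMul G Ω] (F : ContinuousBundleRDS G P X) (g : G) :
    MeasurableSpace.comap (F.skew g) F.baseAlgebra = F.baseAlgebra := by
  have h : MeasurableSpace.comap (fun ω : Ω => g • ω) inferInstance =
      (inferInstance : MeasurableSpace Ω) := by
    refine le_antisymm (measurable_const_smul g).comap_le fun A hA => ?_
    exact ⟨(fun ω : Ω => g⁻¹ • ω) ⁻¹' A, measurable_const_smul g⁻¹ hA, by ext; simp⟩
  calc MeasurableSpace.comap (F.skew g) F.baseAlgebra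
      = MeasurableSpace.comap (fun p : F.E => p.1.1)
          (MeasurableSpace.comap (fun ω : Ω => g • ω) inferInstance) := by
        rw [baseAlgebra, MeasurableSpace.comap_comp, MeasurableSpace.comap_comp]
        rfl
    _ = F.baseAlgebra := by rw [h]

theorem comap_skew_sup [MeasurableConstSMul G Ω] (F : ContinuousBundleRDS G P X) (g : G)
    (α : Set (Set F.E)) :
    MeasurableSpace.comap (F.skew g) (MeasurableSpace.generateFrom α ⊔ F.baseAlgebra) =
      MeasurableSpace.generateFrom ((F.skew g ⁻¹' ·) '' α) ⊔ F.baseAlgebra := by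
  rw [MeasurableSpace.comap_sup, MeasurableSpace.comap_generateFrom, comap_skew_baseAlgebra]

theorem joinOver_empty (F : ContinuousBundleRDS G P X) (α : Set (Set F.E)) :
    F.joinOver α ∅ = {Set.univ} := by
  ext S
  simp [joinOver]

theorem joinOver_insert [DecidableEq G] (F : ContinuousBundleRDS G P X) (α : Set (Set F.E))
    {g : G} {K : Finset G} (hg : g ∉ K) :
    F.joinOver α (insert g K) =
      Set.image2 (· ∩ ·) ((F.skew g ⁻¹' ·) '' α) (F.joinOver α K) := by
  ext S
  constructor
  · rintro ⟨s, hs, rfl⟩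
    refine ⟨_, ⟨s g, hs g (Finset.mem_insert_self _ _), rfl⟩, _,
      ⟨s, fun h hh => hs h (Finset.mem_insert_of_mem hh), rfl⟩, ?_⟩
    rw [Finset.set_biInter_insert]
  · rintro ⟨_, ⟨A, hA, rfl⟩, _, ⟨s, hs, rfl⟩, rfl⟩
    refine ⟨Function.update s g A, fun h hh => ?_, ?_⟩
    · rcases eq_or_ne h g with rfl | hne
      · rwa [Function.update_self]
      · rw [Function.update_of_ne hne]
        exact hs h (Finset.mem_of_mem_insert_of_ne hh hne)
    · rw [Finset.set_biInter_insert, Function.update_self]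
      congr 1
      refine Set.iInter₂_congr fun h hh => ?_
      rw [Function.update_of_ne]
      rintro rfl
      exact hg hh

/-- Since `skew g ∘ skew h = skew (g * h)`, right translation of the index set is a preimage; this
is the source of right invariance of the entropy of joins. -/
theorem joinOver_image_mul_right [DecidableEq G] (F : ContinuousBundleRDS G P X)
    (α : Set (Set F.E)) (K : Finset G) (h : G) :
    F.joinOver α (K.image (· * h)) = (F.skew h ⁻¹' ·) '' F.joinOver α K := by
  have hpre : ∀ s : G → Set F.E, F.skew h ⁻¹' (⋂ g ∈ K, F.skew g ⁻¹' s g) =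
      ⋂ g ∈ K, F.skew (g * h) ⁻¹' s g := by
    intro s
    ext p
    simp [skew_skew]
  ext S
  constructor
  · rintro ⟨s, hs, rfl⟩
    refine ⟨_, ⟨fun g => s (g * h), fun g hg => hs _ (Finset.mem_image_of_mem _ hg), rfl⟩, ?_⟩
    rw [Finset.set_biInter_finset_image]
    exact hpre _
  · rintro ⟨_, ⟨s, hs, rfl⟩, rfl⟩
    refine ⟨fun g => s (g * h⁻¹), fun g hg => ?_, ?_⟩
    · obtain ⟨k, hk, rfl⟩ := Finset.mem_image.1 hg
      simpa using hs k hk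
    · rw [Finset.set_biInter_finset_image]
      simpa using hpre s

section Entropy

variable [MeasurableConstSMul G Ω] (F : ContinuousBundleRDS G P X)

theorem isFinitePartition_joinOver {α : Set (Set F.E)} (hα : IsFinitePartition α)
    (K : Finset G) : IsFinitePartition (F.joinOver α K) := by
  classical
  induction K using Finset.induction_on with
  | empty =>
    rw [joinOver_empty]
    exact isFinitePartition_singleton_univ
  | insert g K hg ih =>
    rw [joinOver_insert F α hg]
    exact (hα.preimage (F.measurable_skew g)).image2_inter ih

theorem generateFrom_joinOver {α : Set (Set F.E)} (hα : IsFinitePartition α) (K : Finset G) :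
    MeasurableSpace.generateFrom (F.joinOver α K) =
      ⨆ g ∈ K, MeasurableSpace.generateFrom ((F.skew g ⁻¹' ·) '' α) := by
  classical
  induction K using Finset.induction_on with
  | empty =>
    rw [joinOver_empty]
    simp
  | insert g K hg ih =>
    rw [joinOver_insert F α hg, generateFrom_image2_inter (hα.preimage (F.measurable_skew g))
      (F.isFinitePartition_joinOver hα K), ih, Finset.iSup_insert]

theorem generateFrom_joinOver_mono {α : Set (Set F.E)} (hα : IsFinitePartition α)
    {S K : Finset G} (h : S ⊆ K) :
    MeasurableSpace.generateFrom (F.joinOver α S) ≤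
      MeasurableSpace.generateFrom (F.joinOver α K) := by
  rw [F.generateFrom_joinOver hα, F.generateFrom_joinOver hα]
  exact biSup_mono h

theorem generateFrom_preimage_le_joinOver {α : Set (Set F.E)} (hα : IsFinitePartition α)
    {g : G} {K : Finset G} (h : g ∈ K) :
    MeasurableSpace.generateFrom ((F.skew g ⁻¹' ·) '' α) ≤
      MeasurableSpace.generateFrom (F.joinOver α K) := by
  rw [F.generateFrom_joinOver hα]
  exact le_biSup (fun g => MeasurableSpace.generateFrom ((F.skew g ⁻¹' ·) '' α)) h

variable [IsProbabilityMeasure P] {F}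

theorem IsInvariant.condEntropy_preimage_base {μ : Measure F.E} (hμ : F.IsInvariant μ) (g : G)
    {α : Set (Set F.E)} (hα : IsFinitePartition α) :
    condEntropy μ ((F.skew g ⁻¹' ·) '' α) F.baseAlgebra = condEntropy μ α F.baseAlgebra := by
  have := hμ.1.isProbabilityMeasure
  rw [← condEntropy_preimage F.baseAlgebra_le ⟨F.measurable_skew g, hμ.2 g⟩
    (F.skew_surjective g) hα, comap_skew_baseAlgebra]

theorem IsInvariant.condEntropy_preimage_sup {μ : Measure F.E} (hμ : F.IsInvariant μ) (g : G)
    {α β : Set (Set F.E)} (hα : IsFinitePartition α) (hβ : IsFinitePartition β) :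
    condEntropy μ ((F.skew g ⁻¹' ·) '' β)
        (MeasurableSpace.generateFrom ((F.skew g ⁻¹' ·) '' α) ⊔ F.baseAlgebra) =
      condEntropy μ β (MeasurableSpace.generateFrom α ⊔ F.baseAlgebra) := by
  have := hμ.1.isProbabilityMeasure
  rw [← condEntropy_preimage (sup_le hα.generateFrom_le F.baseAlgebra_le)
    ⟨F.measurable_skew g, hμ.2 g⟩ (F.skew_surjective g) hβ, comap_skew_sup]

/-- `limUnder` is meaningful only once a limit exists. The entropy of joins is monotone and
submodular by the chain rule and monotonicity in the conditioning, and right invariant because `μ`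
is invariant. -/
theorem IsInvariant.tendsto_fiberEntropy {μ : Measure F.E} (hμ : F.IsInvariant μ)
    {Φ : ℕ → Finset G} (hΦ : IsFolnerSequence Φ) {α : Set (Set F.E)}
    (hα : IsFinitePartition α) :
    Tendsto (fun n => condEntropy μ (F.joinOver α (Φ n)) F.baseAlgebra / ((Φ n).card : ℝ))
      atTop (𝓝 (F.fiberEntropy Φ μ α)) := by
  classical
  have := hμ.1.isProbabilityMeasure
  set φ : Finset G → ℝ := fun K => condEntropy μ (F.joinOver α K) F.baseAlgebra with hφ
  have hp := F.isFinitePartition_joinOver hα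
  have hins : ∀ (K : Finset G) (g : G), g ∉ K → φ (insert g K) = φ K +
      condEntropy μ ((F.skew g ⁻¹' ·) '' α)
        (MeasurableSpace.generateFrom (F.joinOver α K) ⊔ F.baseAlgebra) := by
    intro K g hg
    rw [hφ]
    simp only
    rw [joinOver_insert F α hg, condEntropy_image2_inter F.baseAlgebra_le
      (hα.preimage (F.measurable_skew g)) (hp K)]
  have h0 : φ ∅ = 0 := by
    refine condEntropy_eq_zero F.baseAlgebra_le (hp ∅).finite fun A hA => ?_
    rw [joinOver_empty, Set.mem_singleton_iff] at hA
    rw [hA]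
    exact @MeasurableSet.univ _ F.baseAlgebra
  have hmono : Monotone φ := by
    refine Finset.monotone_iff_forall_le_insert.2 fun K g hg => ?_
    rw [hins K g hg]
    exact le_add_of_nonneg_right (condEntropy_nonneg (hα.preimage (F.measurable_skew g)))
  refine tendsto_nhds_limUnder ⟨_, hΦ.tendsto_of_submodular h0 hmono ?_ ?_⟩
  · intro S K hSK g hg
    rw [hins K g hg, hins S g fun h => hg (hSK h), add_sub_cancel_left, add_sub_cancel_left]
    exact condEntropy_anti (sup_le_sup_right (F.generateFrom_joinOver_mono hα hSK) _)
      (sup_le (hp K).generateFrom_le F.baseAlgebra_le) (hα.preimage (F.measurable_skew g))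
  · intro K h
    rw [hφ]
    simp only
    rw [joinOver_image_mul_right, hμ.condEntropy_preimage_base h (hp K)]

theorem IsInvariant.fiberEntropy_nonneg {μ : Measure F.E} (hμ : F.IsInvariant μ)
    {Φ : ℕ → Finset G} (hΦ : IsFolnerSequence Φ) {α : Set (Set F.E)}
    (hα : IsFinitePartition α) : 0 ≤ F.fiberEntropy Φ μ α := by
  have := hμ.1.isProbabilityMeasure
  exact ge_of_tendsto' (hμ.tendsto_fiberEntropy hΦ hα) fun n =>
    div_nonneg (condEntropy_nonneg (F.isFinitePartition_joinOver hα _)) (Nat.cast_nonneg _)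

theorem IsInvariant.condEntropy_joinOver_le {μ : Measure F.E} (hμ : F.IsInvariant μ)
    {α β : Set (Set F.E)} (hα : IsFinitePartition α) (hβ : IsFinitePartition β) (K : Finset G) :
    condEntropy μ (F.joinOver β K) F.baseAlgebra ≤ condEntropy μ (F.joinOver α K) F.baseAlgebra +
      K.card * condEntropy μ β (MeasurableSpace.generateFrom α ⊔ F.baseAlgebra) := by
  classical
  have := hμ.1.isProbabilityMeasure
  have hαK := F.isFinitePartition_joinOver hα K
  have h𝒞le := sup_le hαK.generateFrom_le F.baseAlgebra_le
  refine (condEntropy_le_add F.baseAlgebra_le (F.isFinitePartition_joinOver hβ K) hαK).trans ?_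
  gcongr
  -- The conditioning on the full join over `K` stays fixed while `S` grows; each `g` then costs at
  -- most the entropy of `g⁻¹ β` given `g⁻¹ α` and the base.
  have key : ∀ S : Finset G, S ⊆ K → condEntropy μ (F.joinOver β S)
      (MeasurableSpace.generateFrom (F.joinOver α K) ⊔ F.baseAlgebra) ≤
      S.card * condEntropy μ β (MeasurableSpace.generateFrom α ⊔ F.baseAlgebra) := by
    intro S
    induction S using Finset.induction_on with
    | empty =>
      intro _
      rw [joinOver_empty, condEntropy_eq_zero h𝒞le (Set.finite_singleton _)]
      · simp
      · intro A hA
        rw [Set.mem_singleton_iff.1 hA]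
        exact @MeasurableSet.univ _ _
    | insert g S hg ih =>
      intro hS
      have h1 := ih ((Finset.subset_insert _ _).trans hS)
      have hgβ := hβ.preimage (F.measurable_skew g)
      have h2 : condEntropy μ ((F.skew g ⁻¹' ·) '' β)
          (MeasurableSpace.generateFrom (F.joinOver α K) ⊔ F.baseAlgebra) ≤
          condEntropy μ β (MeasurableSpace.generateFrom α ⊔ F.baseAlgebra) := by
        rw [← hμ.condEntropy_preimage_sup g hα hβ]
        exact condEntropy_anti (sup_le_sup_right (F.generateFrom_preimage_le_joinOver hα
          (hS (Finset.mem_insert_self _ _))) _) h𝒞le hgβ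
      rw [joinOver_insert F β hg, Finset.card_insert_of_notMem hg, Nat.cast_add, Nat.cast_one]
      have h3 := condEntropy_image2_inter_le (ν := μ) h𝒞le hgβ (F.isFinitePartition_joinOver hβ S)
      linarith
  exact key K subset_rfl

/-- Divide the bound for joins by `|Φ n|` and pass to the limit. Fiber entropy thus depends
continuously on the partition. -/
theorem IsInvariant.fiberEntropy_le_add {μ : Measure F.E} (hμ : F.IsInvariant μ)
    {Φ : ℕ → Finset G} (hΦ : IsFolnerSequence Φ) {α β : Set (Set F.E)}
    (hα : IsFinitePartition α) (hβ : IsFinitePartition β) :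
    F.fiberEntropy Φ μ β ≤ F.fiberEntropy Φ μ α +
      condEntropy μ β (MeasurableSpace.generateFrom α ⊔ F.baseAlgebra) := by
  refine le_of_tendsto_of_tendsto' (hμ.tendsto_fiberEntropy hΦ hβ)
    ((hμ.tendsto_fiberEntropy hΦ hα).add_const _) fun n => ?_
  have hc : (0 : ℝ) < (Φ n).card := Nat.cast_pos.2 (hΦ.1 n).card_pos
  rw [div_add' _ _ _ hc.ne']
  gcongr
  rw [mul_comm _ ((Φ n).card : ℝ)]
  exact hμ.condEntropy_joinOver_le hα hβ (Φ n)

/-- A partition finer than a cover `𝒰` is finer than a partition subordinate to `𝒰`. -/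
theorem _root_.IsFinitePartition.exists_subordinate {Y : Type*} [MeasurableSpace Y]
    {α 𝒰 : Set (Set Y)} (hα : IsFinitePartition α) (h𝒰 : 𝒰.Finite) (h : IsFiner α 𝒰) :
    ∃ β ∈ subordinatePartitions 𝒰, ∀ B ∈ β, MeasurableSet[MeasurableSpace.generateFrom α] B := by
  choose! c hc hAc using h
  have hm : ∀ U : 𝒰, MeasurableSet[MeasurableSpace.generateFrom α] (⋃₀ {A ∈ α | c A = U}) :=
    fun U => MeasurableSet.sUnion (hα.finite.countable.mono fun A hA => hA.1) fun A hA =>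
      MeasurableSpace.measurableSet_generateFrom hA.1
  have := h𝒰.to_subtype
  refine ⟨Set.range fun U : 𝒰 => ⋃₀ {A ∈ α | c A = U}, ⟨⟨⟨Set.finite_range _, ?_, ?_⟩, ?_⟩,
    fun U : 𝒰 => ⋃₀ {A ∈ α | c A = U}, ?_, rfl⟩, ?_⟩
  · rintro _ ⟨U, rfl⟩
    exact hα.generateFrom_le _ (hm U)
  · refine Set.eq_univ_of_forall fun y => ?_
    obtain ⟨A, hA, hyA⟩ := Set.mem_sUnion.1 (hα.sUnion_eq.symm ▸ Set.mem_univ y)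
    exact ⟨_, ⟨⟨c A, hc A hA⟩, rfl⟩, A, ⟨hA, rfl⟩, hyA⟩
  · rintro _ ⟨U, rfl⟩ _ ⟨V, rfl⟩ hne
    refine Set.disjoint_left.2 ?_
    rintro y ⟨A, ⟨hA, hAU⟩, hyA⟩ ⟨A', ⟨hA', hAV⟩, hyA'⟩
    have h1 : A = A' := hα.pairwiseDisjoint.elim_set hA hA' y hyA hyA'
    have h2 : U = V := Subtype.ext (hAU.symm.trans ((congrArg c h1).trans hAV))
    exact hne (by rw [h2])
  · rintro U y ⟨A, ⟨hA, hAU⟩, hyA⟩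
    exact hAU ▸ hAc A hA hyA
  · rintro _ ⟨U, rfl⟩
    exact hm U

/-- A partition finer than `𝒰` can be coarsened to a subordinate one without raising its fiber
entropy, and some `α n` approximates the latter within `ε` in conditional entropy. -/
theorem IsExcellent.isGood {𝒰 : Set (Set F.E)} (h𝒰 : 𝒰.Finite) (h : F.IsExcellent 𝒰) :
    F.IsGood 𝒰 := by
  obtain ⟨α, hα, hclopen, hinf⟩ := h
  refine ⟨α, hα, hclopen, fun Φ hΦ μ hμ => ?_⟩
  have := hμ.1.isProbabilityMeasure
  have hbdd : BddBelow (Set.range fun n => F.fiberEntropy Φ μ (α n)) :=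
    ⟨0, by rintro _ ⟨n, rfl⟩; exact hμ.fiberEntropy_nonneg hΦ (hα n).1⟩
  have hfiner : ∀ β ∈ subordinatePartitions 𝒰, IsFiner β 𝒰 := by
    rintro _ ⟨-, A, hA, rfl⟩ _ ⟨U, rfl⟩
    exact ⟨U, U.2, hA U⟩
  refine le_antisymm (le_ciInf fun n => csInf_le ?_ ⟨α n, (hα n).1, hfiner _ (hα n), rfl⟩)
    (le_csInf ⟨_, α 0, (hα 0).1, hfiner _ (hα 0), rfl⟩ ?_)
  · refine ⟨0, ?_⟩
    rintro _ ⟨γ, hγ, -, rfl⟩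
    exact hμ.fiberEntropy_nonneg hΦ hγ
  · rintro _ ⟨γ, hγ, hγ𝒰, rfl⟩
    obtain ⟨β, hβ, hβγ⟩ := hγ.exists_subordinate h𝒰 hγ𝒰
    refine le_of_forall_pos_lt_add fun ε hε => ?_
    obtain ⟨n, hn⟩ := exists_lt_of_ciInf_lt ((hinf β hβ μ hμ.1).trans_lt hε)
    have h1 := hμ.fiberEntropy_le_add hΦ hγ hβ.1
    rw [condEntropy_eq_zero (sup_le hγ.generateFrom_le F.baseAlgebra_le) hβ.1.finite
      fun B hB => (le_sup_left : MeasurableSpace.generateFrom γ ≤ _) B (hβγ B hB), add_zero] at h1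
    have h2 := hμ.fiberEntropy_le_add hΦ hβ.1 (hα n).1
    have h3 : 0 ≤ condEntropy μ β (MeasurableSpace.generateFrom (α n) ⊔ F.baseAlgebra) :=
      condEntropy_nonneg hβ.1
    have h4 := ciInf_le hbdd n
    linarith

end Entropy

end ContinuousBundleRDS

/-! ### Approximating subordinate partitions from a countable algebra. -/

section Approximation

open scoped symmDiff

variable {Y : Type*} {𝒞 : MeasurableSpace Y} {mY : MeasurableSpace Y}

theorem MeasureTheory.Measure.MeasureDense.exists_measureReal_symmDiff_lt {ν : Measure Y}
    [IsFiniteMeasure ν] {𝒜 : Set (Set Y)} (h : ν.MeasureDense 𝒜) {S : Set Y}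
    (hS : MeasurableSet S) {ε : ℝ} (hε : 0 < ε) : ∃ A ∈ 𝒜, ν.real (S ∆ A) < ε := by
  obtain ⟨A, hA, hlt⟩ := h.approx S hS (measure_ne_top _ _) ε hε
  exact ⟨A, hA, (ENNReal.lt_ofReal_iff_toReal_lt (measure_ne_top _ _)).1 hlt⟩

theorem exists_measureReal_diff_lt {ν : Measure Y} [IsFiniteMeasure ν] {S : ℕ → Set Y}
    (hS : Monotone S) (hSm : ∀ k, MeasurableSet (S k)) {ε : ℝ} (hε : 0 < ε) :
    ∃ k₀, ∀ k ≥ k₀, ν.real ((⋃ k, S k) \ S k) < ε := by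
  have h : Tendsto (fun k => ν.real (S k)) atTop (𝓝 (ν.real (⋃ k, S k))) :=
    (ENNReal.continuousAt_toReal (measure_ne_top _ _)).tendsto.comp
      (tendsto_measure_iUnion_atTop hS)
  obtain ⟨k₀, hk₀⟩ := eventually_atTop.1 (h.eventually_const_lt (sub_lt_self _ hε))
  refine ⟨k₀, fun k hk => ?_⟩
  rw [measureReal_sdiff (Set.subset_iUnion S k) (hSm k)]
  linarith [hk₀ k hk]

/-- If each `U i` is an increasing union of members of an algebra `𝒜` of sets, then partitions
subordinate to `U` are approximated by partitions subordinate to `U` with members in `𝒜`. -/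
theorem MeasureTheory.Measure.MeasureDense.exists_subordinate_family {ν : Measure Y}
    [IsFiniteMeasure ν] {𝒜 : Set (Set Y)} (h𝒜 : IsSetAlgebra 𝒜) (hν : ν.MeasureDense 𝒜) {N : ℕ}
    {S : Fin N → ℕ → Set Y} (hS𝒜 : ∀ i k, S i k ∈ 𝒜) (hSmono : ∀ i, Monotone (S i)) {k₀ : ℕ}
    (hScov : ⋃ i, S i k₀ = Set.univ) {B : Fin N → Set Y} (hBm : ∀ i, MeasurableSet (B i))
    (hBS : ∀ i, B i ⊆ ⋃ k, S i k) (hBdisj : Pairwise (Function.onFun Disjoint B))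
    (hBcov : ⋃ i, B i = Set.univ) {η : ℝ} (hη : 0 < η) :
    ∃ A : Fin N → Set Y, (∀ i, A i ∈ 𝒜) ∧ (∀ i, A i ⊆ ⋃ k, S i k) ∧
      Pairwise (Function.onFun Disjoint A) ∧ (⋃ i, A i = Set.univ) ∧
      ∀ i, ν.real (B i ∆ A i) ≤ η := by
  -- Each of `N` sets will be off by at most `2 * δ`, with total at most `η`; the `+ 1` covers `N =
  -- 0`.
  have hδ : 0 < η / (2 * N + 1) := by positivity
  set δ := η / (2 * N + 1) with hδdef
  choose C hC𝒜 hC using fun i => hν.exists_measureReal_symmDiff_lt (hBm i) hδ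
  choose κ hκ using fun i => exists_measureReal_diff_lt (ν := ν) (hSmono i)
    (fun k => hν.measurable _ (hS𝒜 i k)) hδ
  -- A stage past `k₀` and past every `κ i`: the sets `S i k` cover, and each nearly exhausts its
  -- union.
  set k := k₀ + ∑ i, κ i with hk
  have hkκ : ∀ i, κ i ≤ k := fun i =>
    (Finset.single_le_sum (f := κ) (fun _ _ => Nat.zero_le _) (Finset.mem_univ i)).trans
      (Nat.le_add_left _ _)
  set A₁ : Fin N → Set Y := fun i => C i ∩ S i k with hA₁
  have hA₁𝒜 : ∀ i, A₁ i ∈ 𝒜 := fun i => h𝒜.inter_mem (hC𝒜 i) (hS𝒜 i k)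
  have hclose : ∀ i, ν.real (B i ∆ A₁ i) ≤ 2 * δ := by
    intro i
    have hsub : B i ∆ A₁ i ⊆ (B i ∆ C i) ∪ ((⋃ k, S i k) \ S i k) := by
      intro y hy
      by_cases hys : y ∈ S i k
      · left
        simpa [hA₁, Set.mem_symmDiff, hys] using hy
      · right
        rcases hy with hy | hy
        · exact ⟨hBS i hy.1, hys⟩
        · exact absurd hy.1.2 hys
    calc ν.real (B i ∆ A₁ i) ≤ ν.real ((B i ∆ C i) ∪ ((⋃ k, S i k) \ S i k)) :=
          measureReal_mono hsub
      _ ≤ ν.real (B i ∆ C i) + ν.real ((⋃ k, S i k) \ S i k) := measureReal_union_le _ _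
      _ ≤ 2 * δ := by linarith [hC i, hκ i k (hkκ i)]
  set D : Fin N → Set Y := disjointed fun i => S i k with hD
  have hDcov : ⋃ i, D i = Set.univ := by
    rw [hD, iUnion_disjointed, Set.eq_univ_iff_forall]
    intro y
    obtain ⟨i, hi⟩ := Set.mem_iUnion.1 (hScov.symm ▸ Set.mem_univ y)
    exact Set.mem_iUnion.2 ⟨i, hSmono i (Nat.le_add_right _ _) hi⟩
  have hDS : ∀ i, D i ⊆ S i k := disjointed_subset _
  have hDdisj : Pairwise (Function.onFun Disjoint D) := disjoint_disjointed _
  have hA₂sub : ∀ i, disjointed A₁ i ⊆ A₁ i := disjointed_subset _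
  have hA₂disj : Pairwise (Function.onFun Disjoint (disjointed A₁)) := disjoint_disjointed _
  -- Overlaps of the approximants are removed, and the points they miss are distributed by the
  -- disjointified cover `D`, which respects subordination.
  refine ⟨fun i => disjointed A₁ i ∪ (⋃ j, A₁ j)ᶜ ∩ D i, fun i => ?_, fun i => ?_, ?_, ?_, ?_⟩
  · refine h𝒜.union_mem (h𝒜.isSetRing.disjointed_mem hA₁𝒜 i) (h𝒜.inter_mem (h𝒜.compl_mem ?_)
      (h𝒜.isSetRing.disjointed_mem (fun i => hS𝒜 i k) i))
    simpa using h𝒜.biUnion_mem Finset.univ fun i _ => hA₁𝒜 i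
  · refine Set.union_subset ((hA₂sub i).trans (Set.inter_subset_right.trans
      (Set.subset_iUnion _ k))) (Set.inter_subset_right.trans ((hDS i).trans
      (Set.subset_iUnion _ k)))
  · intro i j hij
    refine Set.disjoint_left.2 ?_
    rintro y (h1 | h1) (h2 | h2)
    · exact Set.disjoint_left.1 (hA₂disj hij) h1 h2
    · exact h2.1 (Set.mem_iUnion.2 ⟨i, hA₂sub i h1⟩)
    · exact h1.1 (Set.mem_iUnion.2 ⟨j, hA₂sub j h2⟩)
    · exact Set.disjoint_left.1 (hDdisj hij) h1.2 h2.2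
  · rw [Set.eq_univ_iff_forall]
    intro y
    by_cases hy : y ∈ ⋃ j, A₁ j
    · rw [← iUnion_disjointed] at hy
      obtain ⟨i, hi⟩ := Set.mem_iUnion.1 hy
      exact Set.mem_iUnion.2 ⟨i, Or.inl hi⟩
    · obtain ⟨i, hi⟩ := Set.mem_iUnion.1 (hDcov.symm ▸ Set.mem_univ y)
      exact Set.mem_iUnion.2 ⟨i, Or.inr ⟨hy, hi⟩⟩
  · intro i
    -- Where every `A₁ j` agrees with `B j`, the `A₁ j` already partition, so neither correction
    -- changes anything.
    have hsub : B i ∆ (disjointed A₁ i ∪ (⋃ j, A₁ j)ᶜ ∩ D i) ⊆ ⋃ j, B j ∆ A₁ j := by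
      intro y hy
      by_contra hne
      have hiff : ∀ j, y ∈ B j ↔ y ∈ A₁ j := by
        intro j
        have : y ∉ B j ∆ A₁ j := fun h => hne (Set.mem_iUnion.2 ⟨j, h⟩)
        rw [Set.mem_symmDiff] at this
        tauto
      obtain ⟨l, hl⟩ := Set.mem_iUnion.1 (hBcov.symm ▸ Set.mem_univ y)
      rcases hy with ⟨h1, h2⟩ | ⟨h1, h2⟩
      · refine h2 (Or.inl ?_)
        have hyU : y ∈ ⋃ j, disjointed A₁ j := by
          rw [iUnion_disjointed]
          exact Set.mem_iUnion.2 ⟨i, (hiff i).1 h1⟩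
        obtain ⟨j, hj⟩ := Set.mem_iUnion.1 hyU
        have hij : i = j := by
          by_contra hij
          exact Set.disjoint_left.1 (hBdisj hij) h1 ((hiff j).2 (hA₂sub j hj))
        exact hij ▸ hj
      · rcases h1 with h1 | h1
        · exact h2 ((hiff i).2 (hA₂sub i h1))
        · exact h1.1 (Set.mem_iUnion.2 ⟨l, (hiff l).1 hl⟩)
    calc ν.real (B i ∆ (disjointed A₁ i ∪ (⋃ j, A₁ j)ᶜ ∩ D i)) ≤ ν.real (⋃ j, B j ∆ A₁ j) :=
          measureReal_mono hsub
      _ ≤ ∑ j, ν.real (B j ∆ A₁ j) := measureReal_iUnion_fintype_le _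
      _ ≤ ∑ j : Fin N, 2 * δ := Finset.sum_le_sum fun j _ => hclose j
      _ ≤ η := by
        rw [Finset.sum_const, Finset.card_univ, Fintype.card_fin, nsmul_eq_mul, hδdef]
        rw [show (N : ℝ) * (2 * (η / (2 * N + 1))) = η * ((2 * N) / (2 * N + 1)) by ring]
        exact mul_le_of_le_one_right hη.le ((div_le_one (by positivity)).2 (by linarith))

/-- Each nonempty member selects an index, injectively, and empty members contribute zero. This
passes from sets of sets to indexed families, which may repeat members. -/
theorem condEntropy_le_sum_family {ν : Measure Y} [IsProbabilityMeasure ν] (hm : 𝒞 ≤ mY) {N : ℕ}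
    {α : Set (Set Y)} (hα : α.Finite) {A : Fin N → Set Y} (hA : ∀ i, MeasurableSet (A i))
    (h : ∀ S ∈ α, S.Nonempty → ∃ i, A i = S) :
    condEntropy ν α 𝒞 ≤ ∑ i, entropyTerm ν (A i) 𝒞 := by
  classical
  rw [condEntropy_eq_sum hα, ← Finset.sum_filter_add_sum_filter_not _ (fun S : Set Y => S.Nonempty)]
  rw [Finset.sum_eq_zero (s := hα.toFinset.filter fun S => ¬ S.Nonempty) fun S hS => ?_, add_zero]
  · rcases isEmpty_or_nonempty (Fin N) with hN | hN
    · rw [Finset.univ_eq_empty, Finset.sum_empty]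
      refine (Finset.sum_eq_zero fun S hS => ?_).le
      have hS' := Finset.mem_filter.1 hS
      exact (h S (hα.mem_toFinset.1 hS'.1) hS'.2).elim fun i _ => isEmptyElim i
    choose! c hc using h
    have hmem : ∀ S ∈ hα.toFinset.filter fun S => S.Nonempty, A (c S) = S := fun S hS =>
      hc S (hα.mem_toFinset.1 (Finset.mem_filter.1 hS).1) (Finset.mem_filter.1 hS).2
    have hinj : Set.InjOn c (hα.toFinset.filter fun S => S.Nonempty : Finset (Set Y)) := by
      intro S hS T hT hST
      rw [← hmem S hS, ← hmem T hT, hST]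
    calc ∑ S ∈ hα.toFinset.filter fun S => S.Nonempty, entropyTerm ν S 𝒞
        = ∑ S ∈ hα.toFinset.filter fun S => S.Nonempty, entropyTerm ν (A (c S)) 𝒞 :=
          Finset.sum_congr rfl fun S hS => by rw [hmem S hS]
      _ = ∑ i ∈ (hα.toFinset.filter fun S => S.Nonempty).image c, entropyTerm ν (A i) 𝒞 :=
          (Finset.sum_image (f := fun i => entropyTerm ν (A i) 𝒞) hinj).symm
      _ ≤ ∑ i, entropyTerm ν (A i) 𝒞 := Finset.sum_le_sum_of_subset_of_nonneg
          (Finset.subset_univ _) fun i _ _ => entropyTerm_nonneg (hA i)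
  · rw [Set.not_nonempty_iff_eq_empty.1 (Finset.mem_filter.1 hS).2, entropyTerm_empty hm]

/-- The members of a finite partition, without repetitions. -/
theorem exists_disjoint_family {N : ℕ} {β : Set (Set Y)} (hβ : IsFinitePartition β)
    {B : Fin N → Set Y} (hB : Set.range B = β) :
    Pairwise (Function.onFun Disjoint (disjointed B)) ∧ (⋃ i, disjointed B i = Set.univ) ∧
      (∀ i, disjointed B i = ∅ ∨ disjointed B i ∈ β) ∧
      ∀ S ∈ β, S.Nonempty → ∃ i, disjointed B i = S := by
  have hcov : ⋃ i, disjointed B i = Set.univ := by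
    rw [iUnion_disjointed, ← hβ.sUnion_eq, ← hB, Set.sUnion_range]
  -- Disjointifying empties a repeated member and leaves its first occurrence intact.
  have hor : ∀ i, disjointed B i = ∅ ∨ disjointed B i = B i := by
    intro i
    by_cases h : ∃ j < i, B j = B i
    · obtain ⟨j, hji, hj⟩ := h
      left
      rw [Set.eq_empty_iff_forall_notMem]
      intro y hy
      rw [disjointed_eq_inter_compl] at hy
      exact (Set.mem_iInter₂.1 hy.2 j hji) (hj ▸ hy.1)
    · push Not at h
      right
      exact disjointed_eq_self fun j hj =>
        hβ.pairwiseDisjoint (hB ▸ Set.mem_range_self j) (hB ▸ Set.mem_range_self i) (h j hj)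
  refine ⟨disjoint_disjointed _, hcov, fun i => ?_, fun S hS ⟨y, hy⟩ => ?_⟩
  · rcases hor i with h | h
    · exact Or.inl h
    · exact Or.inr (h ▸ hB ▸ Set.mem_range_self i)
  · obtain ⟨i, hi⟩ := Set.mem_iUnion.1 (hcov.symm ▸ Set.mem_univ y)
    refine ⟨i, ?_⟩
    rcases hor i with h | h
    · rw [h] at hi
      exact hi.elim
    · rw [h] at hi ⊢
      exact hβ.pairwiseDisjoint.elim_set (hB ▸ Set.mem_range_self i) hS y hi hy

/-- A countable algebra of sets which exhausts the members of a finite cover `𝒰` contains a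
sequence of partitions subordinate to `𝒰` which is dense among all partitions subordinate to `𝒰`,
for each probability measure for which the algebra is dense. -/
theorem exists_dense_subordinatePartitions {𝒜 : Set (Set Y)} (h𝒜 : IsSetAlgebra 𝒜)
    (h𝒜c : 𝒜.Countable) (h𝒜m : ∀ A ∈ 𝒜, MeasurableSet A) {𝒰 : Set (Set Y)} (h𝒰 : 𝒰.Finite)
    {S : Set Y → ℕ → Set Y} (hS𝒜 : ∀ U ∈ 𝒰, ∀ k, S U k ∈ 𝒜) (hSmono : ∀ U ∈ 𝒰, Monotone (S U))
    (hSU : ∀ U ∈ 𝒰, ⋃ k, S U k = U) {k₀ : ℕ} (hScov : ⋃ U ∈ 𝒰, S U k₀ = Set.univ) :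
    ∃ α : ℕ → Set (Set Y), (∀ n, α n ∈ subordinatePartitions 𝒰) ∧ (∀ n, α n ⊆ 𝒜) ∧
      ∀ ν : Measure Y, IsProbabilityMeasure ν → ν.MeasureDense 𝒜 → 𝒞 ≤ mY →
        ∀ β ∈ subordinatePartitions 𝒰, ∀ ε > 0, ∃ n,
          condEntropy ν β (MeasurableSpace.generateFrom (α n) ⊔ 𝒞) +
            condEntropy ν (α n) (MeasurableSpace.generateFrom β ⊔ 𝒞) < ε := by
  have := h𝒰.to_subtype
  obtain ⟨N, ⟨e⟩⟩ := Finite.exists_equiv_fin 𝒰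
  set T : Fin N → ℕ → Set Y := fun i => S (e.symm i) with hT
  have hT𝒜 : ∀ i k, T i k ∈ 𝒜 := fun i k => hS𝒜 _ (e.symm i).2 k
  have hTmono : ∀ i, Monotone (T i) := fun i => hSmono _ (e.symm i).2
  have hTU : ∀ i, ⋃ k, T i k = (e.symm i : Set Y) := fun i => hSU _ (e.symm i).2
  have hTcov : ⋃ i, T i k₀ = Set.univ := by
    rw [← hScov, Set.biUnion_eq_iUnion]
    exact e.symm.surjective.iUnion_comp fun U : 𝒰 => S U k₀
  -- Finite tuples from a countable algebra are countable in number; an enumeration of `Q` is the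
  -- required sequence.
  let Q := {A : Fin N → 𝒜 // (∀ i, (A i : Set Y) ⊆ ⋃ k, T i k) ∧
    Pairwise (Function.onFun Disjoint fun i => (A i : Set Y)) ∧ ⋃ i, (A i : Set Y) = Set.univ}
  have : Countable 𝒜 := h𝒜c.to_subtype
  have hQne : Nonempty Q := by
    refine ⟨⟨fun i => ⟨disjointed (fun i => T i k₀) i,
      h𝒜.isSetRing.disjointed_mem (fun i => hT𝒜 i k₀) i⟩, fun i => ?_,
      disjoint_disjointed _, ?_⟩⟩
    · exact (disjointed_subset (fun i => T i k₀) i).trans (Set.subset_iUnion (T i) k₀)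
    · exact iUnion_disjointed.trans hTcov
  obtain ⟨q, hq⟩ := exists_surjective_nat Q
  have hsub : ∀ A : Q, Set.range (fun i => (A.1 i : Set Y)) ∈ subordinatePartitions 𝒰 := by
    intro A
    refine ⟨⟨⟨Set.finite_range _, ?_, ?_⟩, ?_⟩, fun U => A.1 (e U), fun U => ?_, ?_⟩
    · rintro _ ⟨i, rfl⟩
      exact h𝒜m _ (A.1 i).2
    · rw [Set.sUnion_range]
      exact A.2.2.2
    · rintro _ ⟨i, rfl⟩ _ ⟨j, rfl⟩ hne
      exact A.2.2.1 fun hij => hne (by rw [hij])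
    · have := A.2.1 (e U)
      rwa [hTU, e.symm_apply_apply] at this
    · exact e.surjective.range_comp fun i => (A.1 i : Set Y)
  refine ⟨fun n => Set.range fun i => ((q n).1 i : Set Y), fun n => hsub _, ?_, ?_⟩
  · rintro n _ ⟨i, rfl⟩
    exact ((q n).1 i).2
  intro ν _ hν hm β hβ ε hε
  obtain ⟨hβp, B, hBU, hBβ⟩ := hβ
  have hBe : Set.range (B ∘ e.symm) = β := (e.symm.surjective.range_comp B).trans hBβ
  obtain ⟨hdisj, hcov, hmem, hβmem⟩ := exists_disjoint_family hβp hBe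
  have hBβm : ∀ i, MeasurableSet[MeasurableSpace.generateFrom β] (disjointed (B ∘ e.symm) i) := by
    intro i
    rcases hmem i with h | h
    · rw [h]
      exact @MeasurableSet.empty _ (MeasurableSpace.generateFrom β)
    · exact MeasurableSpace.measurableSet_generateFrom h
  have hBm : ∀ i, MeasurableSet (disjointed (B ∘ e.symm) i) := fun i =>
    hβp.generateFrom_le _ (hBβm i)
  -- The square root of this bound controls `2 * N` entropy terms, each at most `2 * ε / (4 * N +
  -- 1)`, with sum below `ε`.
  have hη : 0 < (ε / (4 * N + 1)) ^ 2 := by positivity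
  obtain ⟨A, hA𝒜, hAT, hAdisj, hAcov, hAB⟩ := hν.exists_subordinate_family h𝒜 hT𝒜 hTmono hTcov
    hBm (fun i => (disjointed_subset _ i).trans ((hBU _).trans (hTU i).ge)) hdisj hcov hη
  obtain ⟨n, hn⟩ := hq ⟨fun i => ⟨A i, hA𝒜 i⟩, hAT, hAdisj, hAcov⟩
  refine ⟨n, ?_⟩
  have hrange : (Set.range fun i => ((q n).1 i : Set Y)) = Set.range A := by rw [hn]
  have hαp : IsFinitePartition (Set.range A) := hrange ▸ (hsub (q n)).1
  simp only [hrange]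
  have hb : ∀ i, √(ν.real (disjointed (B ∘ e.symm) i ∆ A i)) ≤ ε / (4 * N + 1) := fun i =>
    Real.sqrt_le_iff.2 ⟨by positivity, hAB i⟩
  have h1 : condEntropy ν β (MeasurableSpace.generateFrom (Set.range A) ⊔ 𝒞) ≤
      ∑ i : Fin N, 2 * (ε / (4 * N + 1)) := by
    have hle := sup_le hαp.generateFrom_le hm
    refine (condEntropy_le_sum_family hle hβp.finite hBm hβmem).trans
      (Finset.sum_le_sum fun i _ => ?_)
    refine (entropyTerm_le_sqrt hle (hBm i) (B := A i) ?_).trans (by linarith [hb i])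
    exact (le_sup_left : MeasurableSpace.generateFrom (Set.range A) ≤ _) _
      (MeasurableSpace.measurableSet_generateFrom (Set.mem_range_self i))
  have h2 : condEntropy ν (Set.range A) (MeasurableSpace.generateFrom β ⊔ 𝒞) ≤
      ∑ i : Fin N, 2 * (ε / (4 * N + 1)) := by
    have hle := sup_le hβp.generateFrom_le hm
    refine (condEntropy_le_sum_family hle hαp.finite (fun i => h𝒜m _ (hA𝒜 i))
      fun S hS _ => hS).trans (Finset.sum_le_sum fun i _ => ?_)
    refine (entropyTerm_le_sqrt hle (h𝒜m _ (hA𝒜 i)) (B := disjointed (B ∘ e.symm) i) ?_).trans ?_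
    · exact (le_sup_left : MeasurableSpace.generateFrom β ≤ _) _ (hBβm i)
    · rw [symmDiff_comm]
      linarith [hb i]
  refine (add_le_add h1 h2).trans_lt ?_
  rw [Finset.sum_const, Finset.card_univ, Fintype.card_fin, nsmul_eq_mul,
    show (N : ℝ) * (2 * (ε / (4 * N + 1))) + N * (2 * (ε / (4 * N + 1))) =
      4 * N * ε / (4 * N + 1) by ring, div_lt_iff₀ (by positivity)]
  linarith

end Approximation

/-! ### Countable dense families of sets. -/

section Density

open scoped symmDiff

/-- The completed standard Borel measure is separable; its dense family is carried back through `e`,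
and whatever lies outside `Ω₀` is null. -/
theorem IsLebesgueSpace.exists_countable_measureDense {Ω : Type*} [MeasurableSpace Ω]
    {P : Measure Ω} (h : IsLebesgueSpace P) :
    ∃ 𝒟 : Set (Set Ω), 𝒟.Countable ∧ P.MeasureDense 𝒟 := by
  obtain ⟨-, Z, mZ, hZ, p, hp, Ω₀, Z₀, e, hΩ₀, hZ₀, hPΩ₀, -, hpres⟩ := h
  have hsep : IsSeparable p.completion := inferInstance
  obtain ⟨𝒲, h𝒲c, h𝒲⟩ :=
    MeasureTheory.exists_countable_measureDense p.completion
  refine ⟨(fun W => Subtype.val '' (e ⁻¹' (Subtype.val ⁻¹' W))) '' 𝒲, h𝒲c.image _, ?_, ?_⟩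
  · rintro _ ⟨W, hW, rfl⟩
    exact hΩ₀.subtype_image (e.measurable (measurable_subtype_coe (h𝒲.measurable W hW)))
  · intro S hS _ ε hε
    set T : Set (NullMeasurableSpace Z p) :=
      Subtype.val '' (e.symm ⁻¹' (Subtype.val ⁻¹' S)) with hT
    have hTm : MeasurableSet T :=
      hZ₀.subtype_image (e.symm.measurable (measurable_subtype_coe hS))
    have hTtop : p.completion T ≠ ⊤ :=
      (Measure.completion_apply p T).trans_ne (measure_ne_top p T)
    obtain ⟨W, hW, hWε⟩ := h𝒲.approx T hTm hTtop ε hε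
    refine ⟨_, ⟨W, hW, rfl⟩, lt_of_le_of_lt ?_ hWε⟩
    set D : Set Ω := Subtype.val '' (e ⁻¹' (Subtype.val ⁻¹' W)) with hD
    have hpre : (Subtype.val ⁻¹' (S ∆ D) : Set Ω₀) = e ⁻¹' (Subtype.val ⁻¹' (T ∆ W)) := by
      rw [Set.preimage_symmDiff, Set.preimage_symmDiff, Set.preimage_symmDiff, hD, hT,
        Set.preimage_image_eq _ Subtype.val_injective,
        Set.preimage_image_eq _ Subtype.val_injective]
      congr 1
      ext x
      simp
    calc P (S ∆ D) ≤ P (S ∆ D ∩ Ω₀) + P (S ∆ D \ Ω₀) := measure_le_inter_add_sdiff _ _ _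
      _ = P (S ∆ D ∩ Ω₀) := by
        rw [measure_mono_null (Set.sdiff_subset_compl _ _) hPΩ₀, add_zero]
      _ = P.comap Subtype.val (Subtype.val ⁻¹' (S ∆ D) : Set Ω₀) := by
        rw [comap_subtype_coe_apply hΩ₀, Subtype.image_preimage_coe, Set.inter_comm]
      _ = p.completion.comap Subtype.val (Subtype.val ⁻¹' (T ∆ W) : Set Z₀) := by
        rw [hpre, hpres.measure_preimage_equiv]
      _ ≤ p.completion (T ∆ W) := by
        rw [comap_subtype_coe_apply hZ₀]
        exact measure_mono (Set.image_preimage_subset _ _)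

/-- The approximable sets form an algebra containing the generators, hence are dense themselves; two
approximations are then composed. -/
theorem MeasureTheory.IsSetAlgebra.measureDense_of_approx {Y : Type*} [mY : MeasurableSpace Y]
    {ν : Measure Y} [IsFiniteMeasure ν] {𝒜 𝒢 : Set (Set Y)} (h𝒜 : IsSetAlgebra 𝒜)
    (h𝒜m : ∀ A ∈ 𝒜, MeasurableSet A) (h𝒢m : ∀ S ∈ 𝒢, MeasurableSet S)
    (h𝒢 : mY ≤ MeasurableSpace.generateFrom 𝒢)
    (happ : ∀ S ∈ 𝒢, ∀ ε : ℝ, 0 < ε → ∃ A ∈ 𝒜, ν.real (S ∆ A) < ε) : ν.MeasureDense 𝒜 := by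
  set ℬ : Set (Set Y) :=
    {S | MeasurableSet S ∧ ∀ ε : ℝ, 0 < ε → ∃ A ∈ 𝒜, ν.real (S ∆ A) < ε} with hℬ
  have htri : ∀ S T U : Set Y, ν.real (S ∆ U) ≤ ν.real (S ∆ T) + ν.real (T ∆ U) := fun S T U =>
    (measureReal_mono (symmDiff_triangle S T U)).trans (measureReal_union_le _ _)
  have hℬa : IsSetAlgebra ℬ := by
    refine ⟨⟨MeasurableSet.empty, fun ε hε => ⟨∅, h𝒜.empty_mem, by simpa⟩⟩, ?_, ?_⟩
    · rintro S ⟨hS, h⟩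
      refine ⟨hS.compl, fun ε hε => ?_⟩
      obtain ⟨A, hA, hlt⟩ := h ε hε
      exact ⟨Aᶜ, h𝒜.compl_mem hA, by rwa [compl_symmDiff_compl]⟩
    · rintro S T ⟨hS, h⟩ ⟨hT, h'⟩
      refine ⟨hS.union hT, fun ε hε => ?_⟩
      obtain ⟨A, hA, hlt⟩ := h (ε / 2) (half_pos hε)
      obtain ⟨B, hB, hlt'⟩ := h' (ε / 2) (half_pos hε)
      refine ⟨A ∪ B, h𝒜.union_mem hA hB, ?_⟩
      have hsub : (S ∪ T) ∆ (A ∪ B) ⊆ S ∆ A ∪ T ∆ B := by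
        intro y hy
        simp only [Set.mem_symmDiff, Set.mem_union] at hy ⊢
        tauto
      linarith [(measureReal_mono (μ := ν) hsub).trans (measureReal_union_le _ _)]
  have hgen : mY = MeasurableSpace.generateFrom ℬ :=
    le_antisymm (h𝒢.trans (MeasurableSpace.generateFrom_mono fun S hS => ⟨h𝒢m S hS, happ S hS⟩))
      (MeasurableSpace.generateFrom_le fun S hS => hS.1)
  have hdense := Measure.MeasureDense.of_generateFrom_isSetAlgebra_finite ν hℬa hgen
  refine ⟨h𝒜m, fun S hS _ ε hε => ?_⟩
  obtain ⟨T, hT, hST⟩ := hdense.exists_measureReal_symmDiff_lt hS (half_pos hε)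
  obtain ⟨A, hA, hTA⟩ := hT.2 (ε / 2) (half_pos hε)
  refine ⟨A, hA, (ENNReal.lt_ofReal_iff_toReal_lt (measure_ne_top _ _)).2 ?_⟩
  exact (htri S T A).trans_lt (by linarith)

/-- Different indices may give the same member of the cover; the union of their exhaustions is again
an exhaustion of it. -/
theorem exists_dense_subordinatePartitions_range {Y : Type*} {𝒞 mY : MeasurableSpace Y}
    {𝒜 : Set (Set Y)} (h𝒜 : IsSetAlgebra 𝒜)
    (h𝒜c : 𝒜.Countable) (h𝒜m : ∀ A ∈ 𝒜, MeasurableSet A) {J : Type*} [Finite J] {U : J → Set Y}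
    {S : J → ℕ → Set Y} (hS𝒜 : ∀ j k, S j k ∈ 𝒜) (hSmono : ∀ j, Monotone (S j))
    (hSU : ∀ j, ⋃ k, S j k = U j) {k₀ : ℕ} (hScov : ⋃ j, S j k₀ = Set.univ) :
    ∃ α : ℕ → Set (Set Y), (∀ n, α n ∈ subordinatePartitions (Set.range U)) ∧ (∀ n, α n ⊆ 𝒜) ∧
      ∀ ν : Measure Y, IsProbabilityMeasure ν → ν.MeasureDense 𝒜 → 𝒞 ≤ mY →
        ∀ β ∈ subordinatePartitions (Set.range U), ∀ ε > 0, ∃ n,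
          condEntropy ν β (MeasurableSpace.generateFrom (α n) ⊔ 𝒞) +
            condEntropy ν (α n) (MeasurableSpace.generateFrom β ⊔ 𝒞) < ε := by
  classical
  have := Fintype.ofFinite J
  refine exists_dense_subordinatePartitions h𝒜 h𝒜c h𝒜m (Set.finite_range U)
    (S := fun V k => ⋃ j ∈ Finset.univ.filter fun j => U j = V, S j k) (k₀ := k₀)
    (fun V _ k => h𝒜.biUnion_mem _ fun j _ => hS𝒜 j k)
    (fun V _ a b hab => Set.iUnion₂_mono fun j _ => hSmono j hab) ?_ ?_
  · rintro _ ⟨i, rfl⟩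
    ext y
    simp only [Finset.mem_filter, Finset.mem_univ, true_and, Set.mem_iUnion, exists_prop]
    constructor
    · rintro ⟨k, j, hj, hy⟩
      rw [← hj, ← hSU]
      exact Set.mem_iUnion.2 ⟨k, hy⟩
    · intro hy
      rw [← hSU] at hy
      obtain ⟨k, hk⟩ := Set.mem_iUnion.1 hy
      exact ⟨k, i, rfl, hk⟩
  · rw [Set.eq_univ_iff_forall]
    intro y
    obtain ⟨j, hj⟩ := Set.mem_iUnion.1 (hScov.symm ▸ Set.mem_univ y)
    simp only [Finset.mem_filter, Finset.mem_univ, true_and, Set.mem_iUnion, exists_prop]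
    exact ⟨U j, ⟨j, rfl⟩, j, rfl, hj⟩

end Density

/-! ### Clopen exhaustions in zero-dimensional compact spaces. -/

section ZeroDimensional

variable {X : Type*} [TopologicalSpace X] [CompactSpace X] [T2Space X] [TotallyDisconnectedSpace X]
  [SecondCountableTopology X]

theorem countable_setOf_isClopen : {K : Set X | IsClopen K}.Countable := by
  have h : Countable (TopologicalSpace.Clopens X) :=
    TopologicalSpace.Clopens.countable_iff_secondCountable.2 inferInstance
  refine (Set.countable_range fun K : TopologicalSpace.Clopens X => (K : Set X)).mono ?_
  intro K hK
  exact ⟨⟨K, hK⟩, rfl⟩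

/-- Clopen sets form a basis and are countable in number, so finite unions of an enumeration of
those inside `V` exhaust it. -/
theorem IsOpen.exists_monotone_isClopen {V : Set X} (hV : IsOpen V) :
    ∃ K : ℕ → Set X, (∀ k, IsClopen (K k)) ∧ Monotone K ∧ ⋃ k, K k = V := by
  have hc : {K : Set X | IsClopen K ∧ K ⊆ V}.Countable :=
    countable_setOf_isClopen.mono fun K hK => hK.1
  obtain ⟨c, hcr⟩ := hc.exists_eq_range ⟨∅, isClopen_empty, Set.empty_subset V⟩
  have hcK : ∀ i, IsClopen (c i) ∧ c i ⊆ V := fun i => by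
    have h := Set.mem_range_self (f := c) i
    rwa [← hcr] at h
  refine ⟨Set.accumulate c, fun k => ?_, Set.monotone_accumulate, ?_⟩
  · exact (Set.finite_Iic k).isClopen_biUnion fun i _ => (hcK i).1
  · rw [Set.iUnion_accumulate]
    refine Set.Subset.antisymm (Set.iUnion_subset fun i => (hcK i).2) fun x hx => ?_
    obtain ⟨K, hK, hxK, hKV⟩ := isTopologicalBasis_isClopen.mem_nhds_iff.1 (hV.mem_nhds hx)
    obtain ⟨i, hi⟩ : K ∈ Set.range c := hcr ▸ ⟨hK, hKV⟩
    exact Set.mem_iUnion.2 ⟨i, hi.symm ▸ hxK⟩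

/-- The unions over `j` of the stages form an increasing open cover, so by compactness a single
stage covers. -/
theorem exists_monotone_isClopen_cover {J : Type*} {V : J → Set X} (hV : ∀ j, IsOpen (V j))
    (hcov : ⋃ j, V j = Set.univ) :
    ∃ K : J → ℕ → Set X, (∀ j k, IsClopen (K j k)) ∧ (∀ j, Monotone (K j)) ∧
      (∀ j, ⋃ k, K j k = V j) ∧ ∃ k₀, ⋃ j, K j k₀ = Set.univ := by
  choose K hK hmono hKV using fun j => (hV j).exists_monotone_isClopen
  refine ⟨K, hK, hmono, hKV, ?_⟩
  obtain ⟨k₀, hk₀⟩ := isCompact_univ.elim_directed_cover (fun k => ⋃ j, K j k)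
    (fun k => isOpen_iUnion fun j => (hK j k).isOpen) (by
      intro x _
      obtain ⟨j, hj⟩ := Set.mem_iUnion.1 (hcov.symm ▸ Set.mem_univ x)
      rw [← hKV] at hj
      obtain ⟨k, hk⟩ := Set.mem_iUnion.1 hj
      exact Set.mem_iUnion.2 ⟨k, Set.mem_iUnion.2 ⟨j, hk⟩⟩)
    (Monotone.directed_le fun a b hab => Set.iUnion_mono fun j => hmono j hab)
  exact ⟨k₀, Set.univ_subset_iff.1 hk₀⟩

end ZeroDimensional

/-! ### Excellence for zero-dimensional state spaces. -/

namespace ContinuousBundleRDS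

variable {G Ω X : Type*} [Group G] [MulAction G Ω] [MeasurableSpace Ω] {P : Measure Ω}
  [MetricSpace X] [MeasurableSpace X]

/-- The sets `(D × X) ∩ E` with `D ∈ 𝒟` and `(Ω × K) ∩ E` with `K` clopen. -/
def cylinders (F : ContinuousBundleRDS G P X) (𝒟 : Set (Set Ω)) : Set (Set F.E) :=
  (fun D => {p : F.E | p.1.1 ∈ D}) '' 𝒟 ∪ (fun K => {p : F.E | p.1.2 ∈ K}) '' {K | IsClopen K}

/-- The fiber of a base cylinder is everything or nothing, and clopen sets are closed under the
algebra operations; no exceptional `ω` arises. -/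
theorem isClopen_fiberSet_of_mem_generateSetAlgebra (F : ContinuousBundleRDS G P X)
    {𝒟 : Set (Set Ω)} {S : Set F.E} (hS : S ∈ generateSetAlgebra (F.cylinders 𝒟)) (ω : Ω) :
    IsClopen (F.fiberSet S ω) := by
  induction hS with
  | base S hS =>
    rcases hS with ⟨D, -, rfl⟩ | ⟨K, hK, rfl⟩
    · by_cases h : ω ∈ D
      · convert isClopen_univ using 1
        exact Set.eq_univ_of_forall fun x => h
      · convert isClopen_empty using 1
        exact Set.eq_empty_of_forall_notMem fun x hx => h hx
    · exact IsClopen.preimage hK continuous_subtype_val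
  | empty => exact isClopen_empty
  | compl S _ ih => exact ih.compl
  | union S T _ _ ihS ihT => exact ihS.union ihT

theorem measurableSet_of_mem_cylinders [OpensMeasurableSpace X] (F : ContinuousBundleRDS G P X)
    {𝒟 : Set (Set Ω)} (h𝒟 : ∀ D ∈ 𝒟, MeasurableSet D) {S : Set F.E} (hS : S ∈ F.cylinders 𝒟) :
    MeasurableSet S := by
  rcases hS with ⟨D, hD, rfl⟩ | ⟨K, hK, rfl⟩
  · exact F.measurable_base (h𝒟 D hD)
  · exact (measurable_snd.comp measurable_subtype_coe) (IsClopen.isOpen hK).measurableSet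

theorem measurableSet_of_mem_generateSetAlgebra [OpensMeasurableSpace X]
    (F : ContinuousBundleRDS G P X) {𝒟 : Set (Set Ω)} (h𝒟 : ∀ D ∈ 𝒟, MeasurableSet D) {S : Set F.E}
    (hS : S ∈ generateSetAlgebra (F.cylinders 𝒟)) : MeasurableSet S := by
  induction hS with
  | base S hS => exact F.measurableSet_of_mem_cylinders h𝒟 hS
  | empty => exact MeasurableSet.empty
  | compl S _ ih => exact ih.compl
  | union S T _ _ ihS ihT => exact ihS.union ihT

variable [CompactSpace X] [BorelSpace X] [TotallyDisconnectedSpace X]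

theorem le_generateFrom_cylinders (F : ContinuousBundleRDS G P X) :
    (inferInstance : MeasurableSpace F.E) ≤
      MeasurableSpace.generateFrom (F.cylinders {D | MeasurableSet D}) := by
  have hX : (inferInstance : MeasurableSpace X) =
      MeasurableSpace.generateFrom {K : Set X | IsClopen K} := by
    rw [BorelSpace.measurable_eq (α := X)]
    exact isTopologicalBasis_isClopen.borel_eq_generateFrom
  have hE : (inferInstance : MeasurableSpace F.E) =
      MeasurableSpace.comap (fun p : F.E => p.1.1) inferInstance ⊔
        MeasurableSpace.comap (fun p : F.E => p.1.2) inferInstance := by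
    change MeasurableSpace.comap _ (MeasurableSpace.comap _ _ ⊔ MeasurableSpace.comap _ _) = _
    rw [MeasurableSpace.comap_sup, MeasurableSpace.comap_comp, MeasurableSpace.comap_comp]
    rfl
  rw [hE]
  refine sup_le ?_ ?_
  · rintro _ ⟨D, hD, rfl⟩
    exact MeasurableSpace.measurableSet_generateFrom (Or.inl ⟨D, hD, rfl⟩)
  · rw [hX, MeasurableSpace.comap_generateFrom]
    refine MeasurableSpace.generateFrom_mono ?_
    rintro _ ⟨K, hK, rfl⟩
    exact Or.inr ⟨K, hK, rfl⟩

/-- The `μ`-error between base cylinders is the `P`-error between their bases, and clopen cylinders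
lie in the algebra already. Hence the algebra can be chosen independently of `μ`. -/
theorem HasMarginal.measureDense [IsProbabilityMeasure P] {F : ContinuousBundleRDS G P X}
    {μ : Measure F.E} (hμ : F.HasMarginal μ) {𝒟 : Set (Set Ω)} (h𝒟m : ∀ D ∈ 𝒟, MeasurableSet D)
    {𝒟₀ : Set (Set Ω)} (h𝒟 : P.MeasureDense 𝒟₀) (hsub : 𝒟₀ ⊆ 𝒟) :
    μ.MeasureDense (generateSetAlgebra (F.cylinders 𝒟)) := by
  have := hμ.isProbabilityMeasure
  refine isSetAlgebra_generateSetAlgebra.measureDense_of_approx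
    (fun A hA => F.measurableSet_of_mem_generateSetAlgebra h𝒟m hA)
    (fun S hS => F.measurableSet_of_mem_cylinders (fun D hD => hD) hS)
    F.le_generateFrom_cylinders ?_
  rintro _ (⟨S, hS, rfl⟩ | ⟨K, hK, rfl⟩) ε hε
  · obtain ⟨D, hD, hlt⟩ := h𝒟.exists_measureReal_symmDiff_lt hS hε
    refine ⟨_, self_subset_generateSetAlgebra (Or.inl ⟨D, hsub hD, rfl⟩), lt_of_eq_of_lt ?_ hlt⟩
    have hm : MeasurableSet (symmDiff S D) := MeasurableSet.symmDiff hS (h𝒟.measurable D hD)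
    have h := map_measureReal_apply (μ := μ) F.measurable_base hm
    rw [show μ.map (fun p : F.E => p.1.1) = P from hμ] at h
    exact h.symm
  · exact ⟨_, self_subset_generateSetAlgebra (Or.inr ⟨K, hK, rfl⟩), by simpa using hε⟩

/-- Over a Lebesgue space, covers by sets of the form `(C × X) ∩ ((D × X) ∪ (Ω × V)) ∩ E` with `V`
open are excellent if the state space is zero-dimensional. -/
theorem isExcellent_of_totallyDisconnected [IsProbabilityMeasure P] (hP : IsLebesgueSpace P)
    (F : ContinuousBundleRDS G P X) {I J : Type*} [Finite I] [Finite J] {C : I → Set Ω}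
    (hC : ∀ i, MeasurableSet (C i)) (hCcov : ⋃ i, C i = Set.univ) {D : J → Set Ω}
    (hD : ∀ j, MeasurableSet (D j)) {V : J → Set X} (hV : ∀ j, IsOpen (V j))
    (hVcov : ⋃ j, V j = Set.univ) :
    F.IsExcellent (Set.range fun ij : I × J =>
      {p : F.E | p.1.1 ∈ C ij.1 ∧ (p.1.1 ∈ D ij.2 ∨ p.1.2 ∈ V ij.2)}) := by
  obtain ⟨𝒟₀, h𝒟₀c, h𝒟₀⟩ := hP.exists_countable_measureDense
  obtain ⟨K, hK, hKmono, hKV, k₀, hk₀⟩ := exists_monotone_isClopen_cover hV hVcov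
  -- Adding the sets `C i` and `D j` places the exhaustions of the cover exactly in the algebra.
  set 𝒟 : Set (Set Ω) := 𝒟₀ ∪ (Set.range C ∪ Set.range D) with h𝒟
  have h𝒟c : 𝒟.Countable :=
    h𝒟₀c.union ((Set.finite_range C).countable.union (Set.finite_range D).countable)
  have h𝒟m : ∀ S ∈ 𝒟, MeasurableSet S := by
    rintro S (hS | ⟨i, rfl⟩ | ⟨j, rfl⟩)
    exacts [h𝒟₀.measurable S hS, hC i, hD j]
  have halg : IsSetAlgebra (generateSetAlgebra (F.cylinders 𝒟)) := isSetAlgebra_generateSetAlgebra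
  have hcount : (generateSetAlgebra (F.cylinders 𝒟)).Countable :=
    countable_generateSetAlgebra ((h𝒟c.image _).union (countable_setOf_isClopen.image _))
  set S : I × J → ℕ → Set F.E := fun ij k => {p : F.E | p.1.1 ∈ C ij.1} ∩
    ({p : F.E | p.1.1 ∈ D ij.2} ∪ {p : F.E | p.1.2 ∈ K ij.2 k}) with hS
  have hS𝒜 : ∀ ij k, S ij k ∈ generateSetAlgebra (F.cylinders 𝒟) := by
    intro ij k
    refine halg.inter_mem (self_subset_generateSetAlgebra (Or.inl ⟨C ij.1, ?_, rfl⟩))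
      (halg.union_mem (self_subset_generateSetAlgebra (Or.inl ⟨D ij.2, ?_, rfl⟩))
        (self_subset_generateSetAlgebra (Or.inr ⟨K ij.2 k, hK _ _, rfl⟩)))
    · exact Or.inr (Or.inl (Set.mem_range_self _))
    · exact Or.inr (Or.inr (Set.mem_range_self _))
  have hSmono : ∀ ij, Monotone (S ij) := fun ij a b hab =>
    Set.inter_subset_inter_right _ (Set.union_subset_union_right _ fun p hp => hKmono ij.2 hab hp)
  have hSU : ∀ ij : I × J, ⋃ k, S ij k =
      {p : F.E | p.1.1 ∈ C ij.1 ∧ (p.1.1 ∈ D ij.2 ∨ p.1.2 ∈ V ij.2)} := by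
    intro ij
    rw [hS, ← Set.inter_iUnion, ← Set.union_iUnion]
    ext p
    simp [← hKV]
  have hScov : ⋃ ij, S ij k₀ = Set.univ := by
    rw [Set.eq_univ_iff_forall]
    intro p
    obtain ⟨i, hi⟩ := Set.mem_iUnion.1 (hCcov.symm ▸ Set.mem_univ p.1.1)
    obtain ⟨j, hj⟩ := Set.mem_iUnion.1 (hk₀.symm ▸ Set.mem_univ p.1.2)
    exact Set.mem_iUnion.2 ⟨(i, j), hi, Or.inr hj⟩
  obtain ⟨α, hα, hα𝒜, happ⟩ := exists_dense_subordinatePartitions_range (𝒞 := F.baseAlgebra)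
    halg hcount (fun A hA => F.measurableSet_of_mem_generateSetAlgebra h𝒟m hA)
    hS𝒜 hSmono hSU hScov
  refine ⟨α, hα, fun n => Eventually.of_forall fun ω A hA =>
    F.isClopen_fiberSet_of_mem_generateSetAlgebra (hα𝒜 n hA) ω, fun β hβ μ hμ => ?_⟩
  have := hμ.isProbabilityMeasure
  have hnn : ∀ n, 0 ≤ condEntropy μ β (MeasurableSpace.generateFrom (α n) ⊔ F.baseAlgebra) +
      condEntropy μ (α n) (MeasurableSpace.generateFrom β ⊔ F.baseAlgebra) := fun n =>
    add_nonneg (condEntropy_nonneg hβ.1) (condEntropy_nonneg (hα n).1)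
  refine le_antisymm (le_of_forall_pos_le_add fun ε hε => ?_) (Real.iInf_nonneg hnn)
  obtain ⟨n, hn⟩ := happ μ this (hμ.measureDense h𝒟m h𝒟₀ Set.subset_union_left)
    F.baseAlgebra_le β hβ ε hε
  rw [zero_add]
  refine (ciInf_le ⟨0, ?_⟩ n).trans hn.le
  rintro _ ⟨m, rfl⟩
  exact hnn m

end ContinuousBundleRDS

/-! ### The zero-dimensional orbit extension. -/

/-- A space `X'` with a shift action of `G` and maps `coord g : X' → X` which behave like the
coordinates of the full shift `X ^ G`: every point of `X ^ G` is the sequence of coordinates of a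
point of `X'`. -/
structure ShiftExtension (G X X' : Type*) [Group G] [TopologicalSpace X] [TopologicalSpace X'] where
  coord : G → X' → X
  shift : G → X' → X'
  continuous_coord : ∀ g, Continuous (coord g)
  continuous_shift : ∀ g, Continuous (shift g)
  coord_shift : ∀ h g x, coord h (shift g x) = coord (h * g) x
  shift_one : ∀ x, shift 1 x = x
  shift_shift : ∀ g₂ g₁ x, shift g₂ (shift g₁ x) = shift (g₂ * g₁) x
  exists_coord_eq : ∀ f : G → X, ∃ x, ∀ g, coord g x = f g

/-- The full shift over the Cantor space, with coordinates pushed forward along a surjection from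
the Cantor space to `X`. -/
noncomputable def cantorShiftExtension (G : Type*) {X : Type*} [Group G] [Countable G]
    [TopologicalSpace X] (φ : (ℕ → Bool) → X) (hφ : Continuous φ) (hs : Function.Surjective φ) :
    ShiftExtension G X (Shrink.{0} G → ℕ → Bool) where
  -- Indexing by `Shrink.{0} G` places the state space in `Type`, as the notion of factor cover
  -- demands.
  coord g x := φ (x (equivShrink.{0} G g))
  shift g x h := x (equivShrink.{0} G ((equivShrink.{0} G).symm h * g))
  continuous_coord g := hφ.comp (continuous_apply _)
  continuous_shift g := continuous_pi fun h => continuous_apply _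
  coord_shift h g x := by simp
  shift_one x := by simp
  shift_shift g₂ g₁ x := by simp [mul_assoc]
  exists_coord_eq f := by
    choose x hx using fun h => hs (f ((equivShrink.{0} G).symm h))
    exact ⟨x, fun g => by simp [hx]⟩

namespace ContinuousBundleRDS

variable {G Ω X X' : Type*} [Group G] [MulAction G Ω] [MeasurableSpace Ω]
  {P : Measure Ω} [MetricSpace X] [MeasurableSpace X] [MetricSpace X']

/-- The set of all `(ω, x)` for which the coordinates of `x` are an orbit in `E` above `ω`. -/
def orbitSet (F : ContinuousBundleRDS G P X) (σ : ShiftExtension G X X') : Set (Ω × X') :=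
  {p | ∃ h : (p.1, σ.coord 1 p.2) ∈ F.E, ∀ g, F.map g ⟨_, h⟩ = σ.coord g p.2}

/-- The orbit equations make sense only where the coordinate at `1` lies in the fiber of `E`; that
set is closed, and on it the equations are between continuous maps. -/
theorem isClosed_fiber_orbitSet (F : ContinuousBundleRDS G P X) (σ : ShiftExtension G X X') {ω : Ω}
    (hω : IsClosed {x : X | (ω, x) ∈ F.E})
    (hc : ∀ g : G, Continuous fun x : {x : X | (ω, x) ∈ F.E} => F.map g ⟨(ω, x.1), x.2⟩) :
    IsClosed {x | (ω, x) ∈ F.orbitSet σ} := by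
  set A : Set X' := {x | (ω, σ.coord 1 x) ∈ F.E} with hA
  have hAc : IsClosed A := hω.preimage (σ.continuous_coord 1)
  have h : {x | (ω, x) ∈ F.orbitSet σ} =
      Subtype.val '' (⋂ g, {x : A | F.map g ⟨(ω, σ.coord 1 x.1), x.2⟩ = σ.coord g x.1}) := by
    ext x
    constructor
    · rintro ⟨h, hg⟩
      exact ⟨⟨x, h⟩, Set.mem_iInter.2 hg, rfl⟩
    · rintro ⟨y, hy, rfl⟩
      exact ⟨y.2, Set.mem_iInter.1 hy⟩
  rw [h]
  refine hAc.isClosedEmbedding_subtypeVal.isClosedMap _ (isClosed_iInter fun g =>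
    isClosed_eq ?_ ((σ.continuous_coord g).comp continuous_subtype_val))
  exact (hc g).comp
    (((σ.continuous_coord 1).comp continuous_subtype_val).subtype_mk fun x : A => x.2)

/-- The whole orbit of `q` lifts coordinatewise. Nonempty fibers and surjectivity of the projection
both come from this. -/
theorem exists_mem_orbitSet (F : ContinuousBundleRDS G P X) (σ : ShiftExtension G X X') (q : F.E) :
    ∃ x, (q.1.1, x) ∈ F.orbitSet σ ∧ σ.coord 1 x = q.1.2 := by
  obtain ⟨x, hx⟩ := σ.exists_coord_eq fun g => F.map g q
  have h1 : σ.coord 1 x = q.1.2 := (hx 1).trans (F.map_one q)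
  have hq : (q.1.1, σ.coord 1 x) = q.1 := Prod.ext rfl h1
  refine ⟨x, ⟨hq ▸ q.2, fun g => ?_⟩, h1⟩
  exact (congrArg (F.map g) (Subtype.ext hq)).trans (hx g).symm

theorem prodCover_eq_range (F : ContinuousBundleRDS G P X) (ξ : Set (Set Ω)) (𝒱 : Set (Set X)) :
    F.prodCover ξ 𝒱 = Set.range fun CV : ξ × 𝒱 =>
      {p : F.E | p.1.1 ∈ (CV.1 : Set Ω) ∧ (p.1.1 ∈ (∅ : Set Ω) ∨ p.1.2 ∈ (CV.2 : Set X))} := by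
  ext S
  simp only [prodCover, Set.mem_ofPred_eq, Set.mem_range, Prod.exists, Subtype.exists,
    Set.mem_empty_iff_false, false_or, Set.mem_prod]
  constructor
  · rintro ⟨C, hC, V, hV, rfl⟩
    exact ⟨C, hC, V, hV, rfl⟩
  · rintro ⟨C, hC, V, hV, rfl⟩
    exact ⟨C, hC, V, hV, rfl⟩

theorem complCover_eq_range (F : ContinuousBundleRDS G P X) {n : ℕ} (Ωs : Fin n → Set Ω)
    (U : Fin n → Set X) :
    F.complCover Ωs U = Set.range fun ij : Unit × Fin n =>
      {p : F.E | p.1.1 ∈ (Set.univ : Set Ω) ∧ (p.1.1 ∈ (Ωs ij.2)ᶜ ∨ p.1.2 ∈ (U ij.2)ᶜ)} := by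
  have h : ∀ i, {p : F.E | p.1 ∈ Ωs i ×ˢ U i}ᶜ =
      {p : F.E | p.1.1 ∈ (Set.univ : Set Ω) ∧ (p.1.1 ∈ (Ωs i)ᶜ ∨ p.1.2 ∈ (U i)ᶜ)} := by
    intro i
    ext p
    simp only [Set.mem_compl_iff, Set.mem_ofPred_eq, Set.mem_prod, Set.mem_univ, true_and]
    tauto
  simp only [complCover, h]
  ext S
  simp

theorem isOpenRandomCover_range [OpensMeasurableSpace X] (F : ContinuousBundleRDS G P X)
    {I J : Type*} [Finite I] [Finite J] {C : I → Set Ω}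
    (hC : ∀ i, MeasurableSet (C i)) (hCcov : ⋃ i, C i = Set.univ) {D : J → Set Ω}
    (hD : ∀ j, MeasurableSet (D j)) {V : J → Set X} (hV : ∀ j, IsOpen (V j))
    (hVcov : ⋃ j, V j = Set.univ) :
    F.IsOpenRandomCover (Set.range fun ij : I × J =>
      {p : F.E | p.1.1 ∈ C ij.1 ∧ (p.1.1 ∈ D ij.2 ∨ p.1.2 ∈ V ij.2)}) := by
  refine ⟨⟨Set.finite_range _, ?_, ?_⟩, ?_⟩
  · rintro _ ⟨ij, rfl⟩
    exact (F.measurable_base (hC _)).inter ((F.measurable_base (hD _)).union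
      ((measurable_snd.comp measurable_subtype_coe) (hV _).measurableSet))
  · rw [Set.sUnion_range, Set.eq_univ_iff_forall]
    intro p
    obtain ⟨i, hi⟩ := Set.mem_iUnion.1 (hCcov.symm ▸ Set.mem_univ p.1.1)
    obtain ⟨j, hj⟩ := Set.mem_iUnion.1 (hVcov.symm ▸ Set.mem_univ p.1.2)
    exact Set.mem_iUnion.2 ⟨(i, j), hi, Or.inr hj⟩
  · rintro _ ⟨⟨i, j⟩, rfl⟩
    refine Eventually.of_forall fun ω => ?_
    change IsOpen {x : F.fiber ω | ω ∈ C i ∧ (ω ∈ D j ∨ x.1 ∈ V j)}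
    exact isOpen_const.and (isOpen_const.union ((hV j).preimage continuous_subtype_val))

variable [Countable G] [CompactSpace X]

theorem exists_cantorShiftExtension [IsProbabilityMeasure P] (F : ContinuousBundleRDS G P X) :
    Nonempty (ShiftExtension G X (Shrink.{0} G → ℕ → Bool)) := by
  -- A surjection from the Cantor space requires `X` to be nonempty; almost every fiber supplies a
  -- point.
  obtain ⟨ω, ⟨x, -⟩, -⟩ := F.ae_fiber.exists
  have : Nonempty X := ⟨x⟩
  obtain ⟨φ, hφ, hs⟩ := exists_nat_bool_continuous_surjective_of_compact X
  exact ⟨cantorShiftExtension G φ hφ hs⟩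


variable [BorelSpace X] [MeasurableSpace X'] [BorelSpace X']

/-- Countability of `G` makes the orbit condition a countable intersection of measurable equalities.
-/
theorem measurableSet_orbitSet (F : ContinuousBundleRDS G P X) (σ : ShiftExtension G X X') :
    MeasurableSet (F.orbitSet σ) := by
  have hm : Measurable fun p : Ω × X' => (p.1, σ.coord 1 p.2) :=
    measurable_fst.prodMk ((σ.continuous_coord 1).measurable.comp measurable_snd)
  set A : Set (Ω × X') := {p | (p.1, σ.coord 1 p.2) ∈ F.E} with hA
  have hAm : MeasurableSet A := hm F.measurableSet_E
  have h : F.orbitSet σ = Subtype.val '' (⋂ g, {p : A | F.map g ⟨_, p.2⟩ = σ.coord g p.1.2}) := by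
    ext p
    constructor
    · rintro ⟨h, hg⟩
      exact ⟨⟨p, h⟩, Set.mem_iInter.2 hg, rfl⟩
    · rintro ⟨q, hq, rfl⟩
      exact ⟨q.2, Set.mem_iInter.1 hq⟩
  rw [h]
  refine hAm.subtype_image (MeasurableSet.iInter fun g => measurableSet_eq_fun ?_ ?_)
  · exact (F.measurable_map g).comp ((hm.comp measurable_subtype_coe).subtype_mk)
  · exact (σ.continuous_coord g).measurable.comp (measurable_snd.comp measurable_subtype_coe)

variable [CompactSpace X']

/-- The bundle of all orbits of `F`, with the shift action. -/
def orbitExtension (F : ContinuousBundleRDS G P X) (σ : ShiftExtension G X X') :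
    ContinuousBundleRDS G P X' where
  E := F.orbitSet σ
  measurableSet_E := F.measurableSet_orbitSet σ
  map g p := σ.shift g p.1.2
  map_mem g p := by
    obtain ⟨⟨ω, x⟩, h, hg⟩ := p
    have h1 : (g • ω, σ.coord 1 (σ.shift g x)) = (g • ω, F.map g ⟨_, h⟩) := by
      rw [σ.coord_shift, one_mul, hg]
    -- The shifted point has coordinate `k * g` at `k`, which matches the cocycle identity for `F`.
    refine ⟨h1 ▸ F.map_mem g ⟨_, h⟩, fun k => ?_⟩
    exact (congrArg (F.map k) (Subtype.ext h1)).trans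
      ((F.map_map g k ⟨_, h⟩).trans ((hg (k * g)).trans (σ.coord_shift k g x).symm))
  map_one p := σ.shift_one _
  measurable_map g :=
    (σ.continuous_shift g).measurable.comp (measurable_snd.comp measurable_subtype_coe)
  map_map g₁ g₂ p := σ.shift_shift g₂ g₁ _
  ae_fiber := by
    filter_upwards [F.ae_fiber] with ω hω
    obtain ⟨⟨x, hx⟩, hcomp, hcont⟩ := hω
    refine ⟨?_, (F.isClosed_fiber_orbitSet σ hcomp.isClosed hcont).isCompact,
      fun g => (σ.continuous_shift g).comp continuous_subtype_val⟩
    obtain ⟨y, hy, -⟩ := F.exists_mem_orbitSet σ ⟨(ω, x), hx⟩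
    exact ⟨y, hy⟩

/-- The projection of an orbit to its starting point. -/
def orbitProj (F : ContinuousBundleRDS G P X) (σ : ShiftExtension G X X')
    (p : (F.orbitExtension σ).E) : F.E :=
  ⟨(p.1.1, σ.coord 1 p.1.2), p.2.1⟩

theorem isFactorMap_orbitProj (F : ContinuousBundleRDS G P X) (σ : ShiftExtension G X X') :
    IsFactorMap (F.orbitExtension σ) F (F.orbitProj σ) where
  measurable := ((measurable_base _).prodMk ((σ.continuous_coord 1).measurable.comp
    (measurable_snd.comp measurable_subtype_coe))).subtype_mk
  ae_fiber := by
    refine Eventually.of_forall fun ω => ⟨fun p hp => hp,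
      (σ.continuous_coord 1).comp continuous_subtype_val, ?_⟩
    rintro q rfl
    obtain ⟨x, hx, h1⟩ := F.exists_mem_orbitSet σ q
    exact ⟨⟨_, hx⟩, rfl, Subtype.ext (Prod.ext rfl h1)⟩
  equivariant g := by
    refine Eventually.of_forall fun ω p _ => Subtype.ext (Prod.ext rfl ?_)
    change σ.coord 1 (σ.shift g p.1.2) = F.map g _
    rw [σ.coord_shift, one_mul]
    exact (p.2.2 g).symm

/-- Pulling back keeps the base sets and replaces `V j` by its open preimage under the coordinate at
`1`, so the cover keeps its shape. -/
theorem isExcellent_orbitProj_preimage [TotallyDisconnectedSpace X'] [IsProbabilityMeasure P]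
    (hP : IsLebesgueSpace P) (F : ContinuousBundleRDS G P X) (σ : ShiftExtension G X X')
    {I J : Type*} [Finite I] [Finite J] {C : I → Set Ω}
    (hC : ∀ i, MeasurableSet (C i)) (hCcov : ⋃ i, C i = Set.univ) {D : J → Set Ω}
    (hD : ∀ j, MeasurableSet (D j)) {V : J → Set X} (hV : ∀ j, IsOpen (V j))
    (hVcov : ⋃ j, V j = Set.univ) :
    (F.orbitExtension σ).IsExcellent ((fun U => F.orbitProj σ ⁻¹' U) '' Set.range fun ij : I × J =>
      {p : F.E | p.1.1 ∈ C ij.1 ∧ (p.1.1 ∈ D ij.2 ∨ p.1.2 ∈ V ij.2)}) := by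
  rw [← Set.range_comp]
  exact (F.orbitExtension σ).isExcellent_of_totallyDisconnected hP hC hCcov hD
    (V := fun j => σ.coord 1 ⁻¹' V j) (fun j => (hV j).preimage (σ.continuous_coord 1))
    (by rw [← Set.preimage_iUnion, hVcov, Set.preimage_univ])

end ContinuousBundleRDS

/-! ### The two statements. -/

theorem theorem1007212202 {G Ω X : Type*} [Group G] [Countable G] [Infinite G]
    (hG : IsAmenableGroup G)
    [MeasurableSpace Ω] (P : Measure Ω) [IsProbabilityMeasure P]
    [MulAction G Ω] [MeasurableConstSMul G Ω] [SMulInvariantMeasure G Ω P]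
    (hP : IsLebesgueSpace P)
    [MetricSpace X] [CompactSpace X] [MeasurableSpace X] [BorelSpace X]
    (F : ContinuousBundleRDS G P X) :
    (∀ (ξ : Set (Set Ω)) (𝒱 : Set (Set X)), IsFinitePartition ξ → IsFiniteOpenCover 𝒱 →
      F.IsFactorExcellent (F.prodCover ξ 𝒱)) ∧
    (∀ (n : ℕ) (Ωs : Fin n → Set Ω) (U : Fin n → Set X), 2 ≤ n →
      (∀ i, MeasurableSet (Ωs i)) → IsFiniteOpenCover (Set.range fun i => (U i)ᶜ) →
      F.IsFactorGood (F.complCover Ωs U)) := by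
  obtain ⟨σ⟩ := F.exists_cantorShiftExtension
  -- Countability of the index set makes the product metrizable.
  have : Countable (Shrink.{0} G) := (equivShrink.{0} G).symm.injective.countable
  let : MetricSpace (Shrink.{0} G → ℕ → Bool) := TopologicalSpace.metrizableSpaceMetric _
  let : MeasurableSpace (Shrink.{0} G → ℕ → Bool) := borel _
  have hB : BorelSpace (Shrink.{0} G → ℕ → Bool) := ⟨rfl⟩
  refine ⟨fun ξ 𝒱 hξ h𝒱 => ?_, fun n Ωs U _ hΩs hU => ?_⟩
  · have := hξ.finite.to_subtype
    have := h𝒱.finite.to_subtype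
    have h1 : ⋃ C : ξ, (C : Set Ω) = Set.univ := by rw [← Set.sUnion_eq_iUnion, hξ.sUnion_eq]
    have h2 : ⋃ V : 𝒱, (V : Set X) = Set.univ := by rw [← Set.sUnion_eq_iUnion, h𝒱.sUnion_eq]
    rw [ContinuousBundleRDS.prodCover_eq_range]
    exact ⟨F.isOpenRandomCover_range (fun C : ξ => hξ.measurableSet C C.2) h1
        (D := fun _ => ∅) (fun _ => MeasurableSet.empty) (fun V : 𝒱 => h𝒱.isOpen V V.2) h2,
      _, inferInstance, inferInstance, inferInstance, hB, F.orbitExtension σ, F.orbitProj σ,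
      F.isFactorMap_orbitProj σ,
      F.isExcellent_orbitProj_preimage hP σ (fun C : ξ => hξ.measurableSet C C.2) h1
        (D := fun _ => ∅) (fun _ => MeasurableSet.empty) (fun V : 𝒱 => h𝒱.isOpen V V.2) h2⟩
  -- The one-piece partition of `Ω` plays the role of `C`, the complements of the `Ωs i` that of
  -- `D`.
  · have h1 : ⋃ _ : Unit, (Set.univ : Set Ω) = Set.univ := Set.iUnion_const _
    have h2 : ⋃ i, (U i)ᶜ = Set.univ := by rw [← Set.sUnion_range, hU.sUnion_eq]
    have hUo : ∀ i, IsOpen (U i)ᶜ := fun i => hU.isOpen _ (Set.mem_range_self i)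
    rw [ContinuousBundleRDS.complCover_eq_range]
    exact ⟨F.isOpenRandomCover_range (fun _ => MeasurableSet.univ) h1
        (fun i => (hΩs i).compl) hUo h2,
      _, inferInstance, inferInstance, inferInstance, hB, F.orbitExtension σ, F.orbitProj σ,
      F.isFactorMap_orbitProj σ,
      (F.isExcellent_orbitProj_preimage hP σ (fun _ => MeasurableSet.univ) h1
        (fun i => (hΩs i).compl) hUo h2).isGood ((Set.finite_range _).image _)⟩
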